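/- For a finite graph $G=(V,E)$ and $\lambda>0$, let $\mathcal I(G)$ be the set of independent sets of $G$ and let $\mu$ be the Gibbs distribution on $\mathcal I(G)$, $\mu(I)=\lambda^{|I|}/\sum_{J\in\mathcal I(G)}\lambda^{|J|}$. The Glauber dynamics is the Markov chain on $\mathcal I(G)$ which, from a state $X$, chooses $v\in V$ uniformly at random, proposes $X\cup\{v\}$ with probability $\lambda/(1+\lambda)$ and $X\setminus\{v\}$ with probability $1/(1+\lambda)$, moves to the proposed set if it is independent, and otherwise stays at $X$. Its mixing time $T_{\mathrm{mix}}$ is the least $T$ such that, from every initial state, the distribution after $T$ steps is within total variation distance $1/4$ of $\mu$. Let $\mathcal G(n,\Delta)$ be the distribution of the bipartite graph with sides $V_1,V_2$, $|V_1|=|V_2|=n$, obtained as the union of $\Delta$ independent uniformly random perfect matchings between $V_1$ and $V_2$ (multiplicities of edges are ignored). For $\delta>0$ and $i\in\{1,2\}$ let $$\mathcal I_i^\delta=\{I\in\mathcal I(G): |I\cap V_i|>|I\cap V_{3-i}|+\delta n\},\qquad \mathcal I_B^\delta=\{I\in\mathcal I(G): \big||I\cap V_1|-|I\cap V_2|\big|\le\delta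 n\}.$$ Let $\lambda_c(\mathbb T_\Delta)=(\Delta-1)^{\Delta-1}/(\Delta-2)^{\Delta}$, so that $\lambda_c(\mathbb T_3)=4$. **Theorem.** Let $\Delta=3$ and $\lambda>\lambda_c(\mathbb T_3)=4$. There exist $a>1$ and $\delta>0$ such that, with probability tending to $1$ as $n\to\infty$, for $G$ drawn from $\mathcal G(n,3)$ the Gibbs distribution $\mu$ satisfies $$\mu(\mathcal I_B^\delta)\le a^{-n}\min\{\mu(\mathcal I_1^\delta),\mu(\mathcal I_2^\delta)\}.$$ Moreover, the Glauber dynamics is torpidly mixing: there exists $c>0$ such that, with probability tending to $1$ as $n\to\infty$, for $G$ drawn from $\mathcal G(n,3)$ we have $T_{\mathrm{mix}}\ge e^{cn}$. -/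

import Mathlib

open scoped ENNReal

namespace HardCore

/-- The critical activity `(Δ - 1) ^ (Δ - 1) / (Δ - 2) ^ Δ` for uniqueness of the hard-core Gibbs
measure on the infinite `Δ`-regular tree (used for `Δ ≥ 3`). -/
noncomputable def criticalActivity (Δ : ℕ) : ℝ :=
  ((Δ : ℝ) - 1) ^ (Δ - 1) / ((Δ : ℝ) - 2) ^ Δ

theorem criticalActivity_three : criticalActivity 3 = 4 := by
  norm_num [criticalActivity]

section Model

variable {V : Type*} [Fintype V] [DecidableEq V]

/-- The independent sets of `G`. -/
abbrev IndepSet (G : SimpleGraph V) : Type _ := {I : Finset V // G.IsIndepSet (I : Set V)}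

noncomputable instance (G : SimpleGraph V) : Fintype (IndepSet G) := Fintype.ofFinite _

/-- The partition function `Z_G(lam) = ∑_I lam ^ |I|`, over the independent sets of `G`. -/
noncomputable def partitionFunction (G : SimpleGraph V) (lam : ℝ) : ℝ :=
  ∑ I : IndepSet G, lam ^ I.1.card

/-- The Gibbs probability `lam ^ |I| / Z_G(lam)` of a single independent set. -/
noncomputable def gibbs (G : SimpleGraph V) (lam : ℝ) (I : IndepSet G) : ℝ :=
  lam ^ I.1.card / partitionFunction G lam

/-- The Gibbs probability of a set of independent sets. -/
noncomputable def gibbsProb (G : SimpleGraph V) (lam : ℝ) (S : Set (IndepSet G)) : ℝ :=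
  ∑ I : IndepSet G, S.indicator (gibbs G lam) I

open scoped Classical in
/-- Accept the proposed set `X` if it is independent, and otherwise stay at `I`. -/
noncomputable def acceptMove {G : SimpleGraph V} (I : IndepSet G) (X : Finset V) : IndepSet G :=
  if h : G.IsIndepSet (X : Set V) then ⟨X, h⟩ else I

/-- The transition matrix of the Glauber dynamics: a uniform vertex `v` is chosen, `I ∪ {v}` is
proposed with probability `lam / (1 + lam)` and `I \ {v}` with probability `1 / (1 + lam)`, and the
proposal is accepted if and only if it is an independent set. -/
noncomputable def glauber (G : SimpleGraph V) (lam : ℝ) : Matrix (IndepSet G) (IndepSet G) ℝ :=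
  fun I J => (1 / (Fintype.card V : ℝ)) * ∑ v : V,
    (lam / (1 + lam) * (if acceptMove I (insert v I.1) = J then 1 else 0) +
      1 / (1 + lam) * (if acceptMove I (I.1.erase v) = J then 1 else 0))

/-- The total variation distance between two distributions on a finite set. -/
noncomputable def tvDist {α : Type*} [Fintype α] (p q : α → ℝ) : ℝ :=
  (1 / 2) * ∑ x, |p x - q x|

/-- The mixing time of the Glauber dynamics: the least `t` such that, from every initial state, the
distribution after `t` steps is within total variation distance `1 / 4` of the Gibbs distribution
(with the convention that the infimum of the empty set is `⊤`). -/
noncomputable def mixingTime (G : SimpleGraph V) (lam : ℝ) : ℕ∞ :=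
  ⨅ t ∈ {t : ℕ | ∀ I : IndepSet G, tvDist ((glauber G lam ^ t) I) (gibbs G lam) ≤ 1 / 4}, (t : ℕ∞)

end Model

section RandomGraph

/-- The union of the perfect matchings `{ {i, σ k i} : i }`, `k < Δ`, between the two sides
`V₁ = Fin n` (left summand) and `V₂ = Fin n` (right summand), with multiplicities forgotten. -/
def unionOfMatchings {n Δ : ℕ} (σ : Fin Δ → Equiv.Perm (Fin n)) :
    SimpleGraph (Fin n ⊕ Fin n) where
  Adj x y := ∃ (k : Fin Δ) (i : Fin n),
    (x = Sum.inl i ∧ y = Sum.inr (σ k i)) ∨ (y = Sum.inl i ∧ x = Sum.inr (σ k i))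
  symm := ⟨fun _ _ ⟨k, i, h⟩ => ⟨k, i, h.symm⟩⟩
  loopless := ⟨fun x ⟨k, i, h⟩ => by rcases h with ⟨h, h'⟩ | ⟨h, h'⟩ <;> simp [h] at h'⟩

/-- The distribution `𝒢(n, Δ)`: the union of `Δ` independent uniformly random perfect matchings
between two sides of `n` vertices each. -/
noncomputable def randomGraph (n Δ : ℕ) : PMF (SimpleGraph (Fin n ⊕ Fin n)) :=
  (PMF.uniformOfFintype (Fin Δ → Equiv.Perm (Fin n))).map unionOfMatchings

/-- The property `P` holds asymptotically almost surely for `G` drawn from `𝒢(n, Δ)`: its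
probability tends to `1` as `n → ∞`. -/
def AsymptoticallyAlmostSurely (Δ : ℕ)
    (P : (n : ℕ) → SimpleGraph (Fin n ⊕ Fin n) → Prop) : Prop :=
  Filter.Tendsto (fun n => (randomGraph n Δ).toOuterMeasure {G | P n G}) Filter.atTop (nhds 1)

variable {n : ℕ}

/-- `|I ∩ V₁|`. -/
def leftCard (I : Finset (Fin n ⊕ Fin n)) : ℕ := I.toLeft.card

/-- `|I ∩ V₂|`. -/
def rightCard (I : Finset (Fin n ⊕ Fin n)) : ℕ := I.toRight.card

/-- `I_1^δ`: the independent sets with `|I ∩ V₁| > |I ∩ V₂| + δ n`. -/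
def biasedLeft (G : SimpleGraph (Fin n ⊕ Fin n)) (δ : ℝ) : Set (IndepSet G) :=
  {I | (leftCard I.1 : ℝ) > (rightCard I.1 : ℝ) + δ * n}

/-- `I_2^δ`: the independent sets with `|I ∩ V₂| > |I ∩ V₁| + δ n`. -/
def biasedRight (G : SimpleGraph (Fin n ⊕ Fin n)) (δ : ℝ) : Set (IndepSet G) :=
  {I | (rightCard I.1 : ℝ) > (leftCard I.1 : ℝ) + δ * n}

/-- `I_B^δ`: the nearly balanced independent sets, `||I ∩ V₁| - |I ∩ V₂|| ≤ δ n`. -/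
def nearlyBalanced (G : SimpleGraph (Fin n ⊕ Fin n)) (δ : ℝ) : Set (IndepSet G) :=
  {I | (leftCard I.1 : ℝ) ≤ (rightCard I.1 : ℝ) + δ * n ∧
    (rightCard I.1 : ℝ) ≤ (leftCard I.1 : ℝ) + δ * n}

end RandomGraph

end HardCore

/-! The proof compares a lower bound for partition functions valid for every graph with a
first-moment upper bound; no second moment is needed.

Deterministic side. Summing out the right vertices of a bipartite graph leaves a log-supermodular
weight on left configurations. For such weights the partition function of a `k`-fold cover is at
most the `k`-th power of that of the base (`sum_liftWeight_le`). Averaging over all permutation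
voltages, keeping only configurations with the same number of occupied points in every left fibre
and in every right fibre, and letting `k → ∞` gives the Bethe lower bound `exp_le_leftPartition`,
for separate activities on the two sides. Its exponent contains the same function `entropyRate` that
governs the expected number of independent pairs in the random graph, because `expectedPairs`
appears in both computations.

Analytic side. For `lam > 4` the function `freeEnergy` is maximal only off the diagonal and stays
below its maximum by a fixed amount near the diagonal (`exists_freeEnergy_gap`).

Random side. By Markov's inequality, with high probability the total weight is at most about `exp (n
* M)`, where `M` is the maximum, and the balanced weight is exponentially smaller. Multiply the
activity by `exp ε` on one side and by `exp (-ε)` on the other. The Bethe bound makes the tilted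
partition function at least `exp (n * (M + δ * ε))`; the balanced and oppositely biased
configurations cannot supply this, so the biased weight must be large (`weightOf_balanced_le`).
Tilting both ways treats both sides on the same graph.

Mixing. One update cannot cross from one biased class to the other, so a stationary trajectory must
pass through the balanced class. This happens by time `t` with probability at most `t` times the
balanced mass (`sum_pow_le_of_separated`), which forces exponential mixing time. -/

namespace HardCore

/-! ### Log-supermodular weights on subsets of a `k`-point set. -/

section Supermodular

open Finset

/-- Summation by parts: a nonincreasing sequence with values in `[0, 1]` tested against increments
of a nonnegative sequence. -/
theorem abel_nonneg_nat (p D : ℕ → ℝ) (hp : Antitone p) (hp1 : p 0 ≤ 1) (hp0 : ∀ j, 0 ≤ p j)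
    (hD : ∀ j, 0 ≤ D j) (m : ℕ) : 0 ≤ D 0 + ∑ j ∈ range m, p j * (D (j + 1) - D j) := by
  have key : ∀ m, p m * D m ≤ p 0 * D 0 + ∑ j ∈ range m, p j * (D (j + 1) - D j) := by
    intro m
    induction m with
    | zero => simp
    | succ m ih =>
      rw [sum_range_succ]
      have := mul_le_mul_of_nonneg_right (hp (Nat.le_succ m)) (hD (m + 1))
      simp only [Nat.succ_eq_add_one] at this
      linarith
  have h1 := key m
  have h2 := mul_nonneg (hp0 m) (hD m)
  have h3 := mul_le_mul_of_nonneg_right hp1 (hD 0)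
  linarith

theorem abel_nonneg {k : ℕ} (p : Fin k → ℝ) (D : ℕ → ℝ) (hp : Antitone p) (hp1 : ∀ j, p j ≤ 1)
    (hp0 : ∀ j, 0 ≤ p j) (hD : ∀ j, 0 ≤ D j) :
    0 ≤ D 0 + ∑ j : Fin k, p j * (D (j + 1) - D j) := by
  -- Extension by zero past `k` keeps the sequence antitone because `p` is nonnegative.
  set p' : ℕ → ℝ := fun j => if h : j < k then p ⟨j, h⟩ else 0 with hp'
  have h := abel_nonneg_nat p' D ?_ ?_ ?_ hD k
  · rw [Finset.sum_range] at h
    convert h using 4 with j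
    simp [hp']
  · intro i j hij
    by_cases hj : j < k
    · have hi : i < k := lt_of_le_of_lt hij hj
      simp only [hp', hj, hi, dif_pos]
      exact hp (by simpa using hij)
    · simp only [hp', hj, dif_neg, not_false_eq_true]
      split_ifs
      · exact hp0 _
      · exact le_rfl
  · simp only [hp']
    split_ifs
    · exact hp1 _
    · exact zero_le_one
  · intro j
    simp only [hp']
    split_ifs
    · exact hp0 _
    · exact le_rfl

/-- The initial segment `{i | i < s}` of `Fin k`. -/
def initSeg (k s : ℕ) : Finset (Fin k) := univ.filter fun i => (i : ℕ) < s

/-- A supermodular set function lies below the modular function which agrees with it along a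
maximal chain. -/
theorem supermodular_le_modular {k : ℕ} (φ : Finset (Fin k) → ℝ)
    (hφ : ∀ S T, φ S + φ T ≤ φ (S ∩ T) + φ (S ∪ T)) (S : Finset (Fin k)) :
    φ S ≤ φ ∅ + ∑ j : Fin k,
      (if j ∈ S then 1 else 0) * (φ (initSeg k (j + 1)) - φ (initSeg k j)) := by
  have key : ∀ m : ℕ, m ≤ k → φ (S ∩ initSeg k m) ≤ φ ∅ + ∑ j ∈ initSeg k m,
      (if j ∈ S then 1 else 0) * (φ (initSeg k (j + 1)) - φ (initSeg k j)) := by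
    intro m
    induction m with
    | zero => intro _; simp [initSeg]
    | succ m ih =>
      intro hm
      have ih := ih (by omega)
      have hseg : initSeg k (m + 1) = insert ⟨m, hm⟩ (initSeg k m) := by
        ext i
        simp only [initSeg, mem_filter, mem_univ, true_and, mem_insert, Fin.ext_iff]
        omega
      have hnot : (⟨m, hm⟩ : Fin k) ∉ initSeg k m := by simp [initSeg]
      rw [hseg, sum_insert hnot]
      by_cases hS : (⟨m, hm⟩ : Fin k) ∈ S
      -- Increasing differences: adding `m` to `S ∩ initSeg k m` gains at most what adding it to the
      -- larger set `initSeg k m` gains.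
      · have h := hφ (S ∩ initSeg k (m + 1)) (initSeg k m)
        have e1 : S ∩ initSeg k (m + 1) ∩ initSeg k m = S ∩ initSeg k m := by
          rw [hseg]; ext i; simp only [mem_inter, mem_insert]; tauto
        have e2 : S ∩ initSeg k (m + 1) ∪ initSeg k m = initSeg k (m + 1) := by
          rw [hseg]; ext i; simp only [mem_inter, mem_insert, mem_union]
          constructor
          · tauto
          · rintro (rfl | h) <;> tauto
        rw [e1, e2, hseg] at h
        simp only [hS, if_true, one_mul, hseg]
        linarith
      · have e1 : S ∩ insert ⟨m, hm⟩ (initSeg k m) = S ∩ initSeg k m := by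
          ext i; simp only [mem_inter, mem_insert]
          constructor
          · rintro ⟨h1, rfl | h2⟩
            · exact absurd h1 hS
            · exact ⟨h1, h2⟩
          · tauto
        rw [e1]
        simpa [hS] using ih
  have hu : initSeg k k = univ := by ext i; simp [initSeg]
  have := key k le_rfl
  rwa [hu, inter_univ] at this

/-- Gibbs' inequality: if the relative entropy of `h` with respect to `w` is nonpositive, then `h`
has at most the total mass of `w`. -/
theorem sum_le_sum_of_entropy {α : Type*} [Fintype α] [Nonempty α] (h w : α → ℝ)
    (hh : ∀ x, 0 < h x) (hw : ∀ x, 0 < w x)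
    (H : ∑ x, h x * Real.log (h x) ≤ ∑ x, h x * Real.log (w x)) : ∑ x, h x ≤ ∑ x, w x := by
  set Z := ∑ x, h x with hZ
  set W := ∑ x, w x with hW
  have hZp : 0 < Z := sum_pos (fun x _ => hh x) univ_nonempty
  have hWp : 0 < W := sum_pos (fun x _ => hw x) univ_nonempty
  have h1 : ∀ x, h x * (Real.log (w x) - Real.log (h x) + (Real.log Z - Real.log W))
      ≤ w x * (Z / W) - h x := by
    intro x
    -- `log t ≤ t - 1` at the ratio of the two normalized densities; the resulting upper bounds sum
    -- to zero.
    have h2 := Real.log_le_sub_one_of_pos (show 0 < w x * Z / (h x * W) from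
      div_pos (mul_pos (hw x) hZp) (mul_pos (hh x) hWp))
    rw [Real.log_div (mul_pos (hw x) hZp).ne' (mul_pos (hh x) hWp).ne',
      Real.log_mul (hw x).ne' hZp.ne', Real.log_mul (hh x).ne' hWp.ne'] at h2
    have h3 := mul_le_mul_of_nonneg_left h2 (hh x).le
    have h4 : h x * (w x * Z / (h x * W) - 1) = w x * (Z / W) - h x := by
      have := (hh x).ne'
      field_simp
    rw [h4] at h3
    linarith
  have h2 := sum_le_sum fun x (_ : x ∈ univ) => h1 x
  have h3 : ∑ x, (w x * (Z / W) - h x) = 0 := by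
    rw [sum_sub_distrib, ← sum_mul, ← hW, ← hZ]
    field_simp
    simp
  have h4 : ∑ x, h x * (Real.log (w x) - Real.log (h x) + (Real.log Z - Real.log W))
      = ∑ x, h x * Real.log (w x) - ∑ x, h x * Real.log (h x)
        + Z * (Real.log Z - Real.log W) := by
    rw [hZ, sum_mul, ← sum_sub_distrib, ← sum_add_distrib]
    exact sum_congr rfl fun x _ => by ring
  rw [h3, h4] at h2
  have h5 : Z * (Real.log Z - Real.log W) ≤ 0 := by linarith
  have h6 : Real.log Z ≤ Real.log W := by
    by_contra hcon
    push Not at hcon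
    have := mul_pos hZp (sub_pos.2 hcon)
    linarith
  exact (Real.log_le_log_iff hZp hWp).1 h6

theorem sum_prod_ite {k : ℕ} (a b : Fin k → ℝ) :
    ∑ S : Finset (Fin k), ∏ i, (if i ∈ S then b i else a i) = ∏ i, (a i + b i) := by
  rw [show (∏ i, (a i + b i)) = ∏ i, (b i + a i) from prod_congr rfl fun i _ => add_comm _ _,
    Fintype.prod_add]
  refine sum_congr rfl fun S _ => ?_
  rw [← prod_mul_prod_compl S]
  congr 1
  · exact prod_congr rfl fun i hi => by simp [hi]
  · exact prod_congr rfl fun i hi => by simp [mem_compl.1 hi]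

/-- A log-supermodular weight on subsets of `Fin k`, bounded at each set by the value of a product
weight at the initial segment of the same size, has at most the total mass of the product weight:
the case of nonincreasing marginals. -/
theorem sum_le_prod_of_antitone {k : ℕ} (h : Finset (Fin k) → ℝ) (a b : Fin k → ℝ)
    (hh : ∀ S, 0 < h S) (ha : ∀ i, 0 < a i) (hb : ∀ i, 0 < b i)
    (hsup : ∀ S T, h S * h T ≤ h (S ∩ T) * h (S ∪ T))
    (hle : ∀ S, h S ≤ ∏ i : Fin k, if (i : ℕ) < S.card then b i else a i)
    (hanti : Antitone fun j : Fin k => ∑ S : Finset (Fin k), h S * if j ∈ S then 1 else 0) :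
    ∑ S, h S ≤ ∏ i, (a i + b i) := by
  rw [← sum_prod_ite]
  set w : Finset (Fin k) → ℝ := fun S => ∏ i, if i ∈ S then b i else a i with hw
  have hwpos : ∀ S, 0 < w S := fun S => prod_pos fun i _ => by split_ifs <;> simp [ha, hb]
  refine sum_le_sum_of_entropy h w hh hwpos ?_
  set φ : Finset (Fin k) → ℝ := fun S => Real.log (h S) with hφ
  have hφsup : ∀ S T, φ S + φ T ≤ φ (S ∩ T) + φ (S ∪ T) := by
    intro S T
    simp only [hφ]
    rw [← Real.log_mul (hh _).ne' (hh _).ne', ← Real.log_mul (hh _).ne' (hh _).ne']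
    exact Real.log_le_log (mul_pos (hh _) (hh _)) (hsup S T)
  set Z := ∑ S, h S with hZ
  have hZpos : 0 < Z := sum_pos (fun x _ => hh x) univ_nonempty
  set q : Fin k → ℝ := fun j => ∑ S : Finset (Fin k), h S * if j ∈ S then 1 else 0 with hq
  have hq0 : ∀ j, 0 ≤ q j := fun j => sum_nonneg fun S _ =>
    mul_nonneg (hh S).le (by split_ifs <;> norm_num)
  have hq1 : ∀ j, q j ≤ Z := fun j => sum_le_sum fun S _ =>
    mul_le_of_le_one_right (hh S).le (by split_ifs <;> norm_num)
  -- `D s` is the deficit of `log h` below `log w` on the `s`-th set of the chain. The entropy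
  -- inequality reduces to the mean of the deficit's modular extension being nonnegative, which is
  -- summation by parts against the nonincreasing marginals `q`.
  set D : ℕ → ℝ := fun s => (∑ i : Fin k, if (i : ℕ) < s then Real.log (b i) else Real.log (a i))
    - φ (initSeg k s) with hD
  have hDle : ∀ s ≤ k, 0 ≤ D s := by
    intro s hs
    have hcard : (initSeg k s).card = s := by
      simp only [initSeg]
      rw [Fin.card_filter_val_lt]
      omega
    have h1 := Real.log_le_log (hh _) (hle (initSeg k s))
    rw [hcard, Real.log_prod (fun i _ => by split_ifs <;> simp [(ha i).ne', (hb i).ne'])] at h1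
    simp only [hD, hφ, sub_nonneg]
    refine h1.trans (le_of_eq (sum_congr rfl fun i _ => by split_ifs <;> rfl))
  have hDk : ∀ s, k ≤ s → D s = D k := by
    intro s hs
    have : initSeg k s = initSeg k k := by ext i; simp [initSeg]; omega
    simp only [hD, this]
    congr 1
    refine sum_congr rfl fun i _ => ?_
    rw [if_pos (by omega), if_pos (by omega)]
  have hD0 : ∀ s, 0 ≤ D s := fun s => by
    rcases le_total s k with hs | hs
    · exact hDle s hs
    · rw [hDk s hs]; exact hDle k le_rfl
  have habel := abel_nonneg (fun j => q j / Z) D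
    (fun i j hij => div_le_div_of_nonneg_right (hanti hij) hZpos.le)
    (fun j => (div_le_one hZpos).2 (hq1 j)) (fun j => div_nonneg (hq0 j) hZpos.le) hD0
  have hinc : ∀ j : Fin k, D (j + 1) - D j =
      (Real.log (b j) - Real.log (a j)) - (φ (initSeg k (j + 1)) - φ (initSeg k j)) := by
    intro j
    have : (∑ i : Fin k, if (i : ℕ) < j + 1 then Real.log (b i) else Real.log (a i))
        - (∑ i : Fin k, if (i : ℕ) < j then Real.log (b i) else Real.log (a i))
        = Real.log (b j) - Real.log (a j) := by
      rw [← sum_sub_distrib, sum_eq_single j]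
      · simp
      · intro i _ hij
        have : (i : ℕ) ≠ j := fun h => hij (Fin.ext h)
        by_cases h1 : (i : ℕ) < j
        · simp [h1, Nat.lt_succ_of_lt h1]
        · rw [if_neg (by omega), if_neg h1, sub_self]
      · simp
    simp only [hD]
    linarith
  have hmul : 0 ≤ Z * D 0 + ∑ j : Fin k, q j * (D (j + 1) - D j) := by
    have := mul_nonneg hZpos.le habel
    rw [mul_add, mul_sum] at this
    refine this.trans_eq (congrArg _ (sum_congr rfl fun j _ => ?_))
    field_simp
  have hlog : ∀ S, Real.log (w S) = ∑ j, Real.log (a j)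
      + ∑ j, (if j ∈ S then 1 else 0) * (Real.log (b j) - Real.log (a j)) := by
    intro S
    simp only [hw]
    rw [Real.log_prod (fun i _ => by split_ifs <;> simp [(ha i).ne', (hb i).ne']),
      ← sum_add_distrib]
    refine sum_congr rfl fun i _ => by split_ifs <;> ring
  have hD00 : D 0 = ∑ j, Real.log (a j) - φ ∅ := by
    have : initSeg k 0 = ∅ := by ext i; simp [initSeg]
    simp [hD, this]
  have hswap : ∀ c : Fin k → ℝ, ∑ S, h S * ∑ j, (if j ∈ S then 1 else 0) * c j
      = ∑ j, q j * c j := by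
    intro c
    simp only [mul_sum, hq, sum_mul]
    rw [sum_comm]
    exact sum_congr rfl fun j _ => sum_congr rfl fun S _ => by ring
  calc ∑ S, h S * Real.log (h S)
      ≤ ∑ S, h S * (φ ∅ + ∑ j : Fin k,
        (if j ∈ S then 1 else 0) * (φ (initSeg k (j + 1)) - φ (initSeg k j))) :=
        sum_le_sum fun S _ => mul_le_mul_of_nonneg_left (supermodular_le_modular φ hφsup S) (hh S).le
    _ = Z * φ ∅ + ∑ j, q j * (φ (initSeg k (j + 1)) - φ (initSeg k j)) := by
        simp only [mul_add, sum_add_distrib]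
        rw [hswap fun j => φ (initSeg k (j + 1)) - φ (initSeg k j), hZ, sum_mul]
    _ ≤ Z * ∑ j, Real.log (a j) + ∑ j, q j * (Real.log (b j) - Real.log (a j)) := by
        rw [hD00] at hmul
        simp only [hinc, mul_sub, sum_sub_distrib] at hmul ⊢
        linarith
    _ = ∑ S, h S * Real.log (w S) := by
        simp only [hlog, mul_add, sum_add_distrib]
        rw [hswap fun j => Real.log (b j) - Real.log (a j), hZ, sum_mul]

/-- The domination hypothesis sees only the cardinality of `S`, and log-supermodularity is invariant
under relabelling points, so the points can be sorted by decreasing marginal. -/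
theorem sum_le_prod_of_logSupermodular {k : ℕ} (h : Finset (Fin k) → ℝ) (a b : Fin k → ℝ)
    (hh : ∀ S, 0 < h S) (ha : ∀ i, 0 < a i) (hb : ∀ i, 0 < b i)
    (hsup : ∀ S T, h S * h T ≤ h (S ∩ T) * h (S ∪ T))
    (hle : ∀ S, h S ≤ ∏ i : Fin k, if (i : ℕ) < S.card then b i else a i) :
    ∑ S, h S ≤ ∏ i, (a i + b i) := by
  set q : Fin k → ℝ := fun j => ∑ S : Finset (Fin k), h S * if j ∈ S then 1 else 0 with hq
  set τ : Equiv.Perm (Fin k) := Tuple.sort fun j => - q j with hτ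
  have hmono : Monotone ((fun j => - q j) ∘ τ) := Tuple.monotone_sort _
  set e : Finset (Fin k) ≃ Finset (Fin k) := τ.finsetCongr with he
  have hinter : ∀ S T, e (S ∩ T) = e S ∩ e T := fun S T => by
    simp [he, Equiv.finsetCongr_apply, map_inter]
  have hunion : ∀ S T, e (S ∪ T) = e S ∪ e T := fun S T => by
    simp [he, Equiv.finsetCongr_apply, map_union]
  rw [← Equiv.sum_comp e]
  refine sum_le_prod_of_antitone (fun S => h (e S)) a b (fun S => hh _) ha hb ?_ ?_ ?_
  · intro S T
    simp only [hinter, hunion]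
    exact hsup _ _
  · intro S
    have := hle (e S)
    simpa [he, Equiv.finsetCongr_apply] using this
  · intro i j hij
    have h1 : ∀ i, ∑ S, h (e S) * (if i ∈ S then (1 : ℝ) else 0) = q (τ i) := by
      intro i
      simp only [hq]
      rw [← Equiv.sum_comp e (fun S => h S * if τ i ∈ S then (1 : ℝ) else 0)]
      refine sum_congr rfl fun S _ => ?_
      simp [he, Equiv.finsetCongr_apply]
    simp only [h1]
    have := hmono hij
    simp only [Function.comp] at this
    linarith

end Supermodular

/-! ### Partition functions of finite covers. -/

section Lift

open Finset

/-- A log-supermodular weight on `k`-tuples of configurations which is dominated by a product weight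
at the sorted tuple has at most the `k`-th power of the total mass of the latter. -/
theorem sum_le_pow_of_logSupermodular {k : ℕ} : ∀ {N : ℕ} (g : (Fin N → Finset (Fin k)) → ℝ)
    (f : (Fin N → Bool) → ℝ) (_ : ∀ x, 0 < g x) (_ : ∀ z, 0 < f z)
    (_ : ∀ x y, g x * g y ≤ g (x ⊓ y) * g (x ⊔ y))
    (_ : ∀ x, g x ≤ ∏ i : Fin k, f fun u => decide ((i : ℕ) < (x u).card)),
    ∑ x, g x ≤ (∑ z, f z) ^ k
  | 0, g, f, hg, hf, hsup, hle => by
    rw [Fintype.sum_eq_single (default : Fin 0 → Finset (Fin k))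
        (fun x hx => absurd (Subsingleton.elim _ _) hx),
      Fintype.sum_eq_single (default : Fin 0 → Bool)
        (fun x hx => absurd (Subsingleton.elim _ _) hx)]
    refine (hle default).trans (le_of_eq ?_)
    rw [prod_congr rfl (g := fun _ => f default) (fun i _ => congrArg f (Subsingleton.elim _ _))]
    simp
  | N + 1, g, f, hg, hf, hsup, hle => by
    rw [← Equiv.sum_comp (Fin.consEquiv fun _ => Finset (Fin k)) g,
      ← Equiv.sum_comp (Fin.consEquiv fun _ => Bool) f, Fintype.sum_prod_type_right,
      Fintype.sum_prod_type_right]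
    refine sum_le_pow_of_logSupermodular
      (fun x => ∑ S : Finset (Fin k), g (Fin.consEquiv (fun _ => Finset (Fin k)) (S, x)))
      (fun z => ∑ c : Bool, f (Fin.consEquiv (fun _ => Bool) (c, z)))
      (fun x => sum_pos (fun _ _ => hg _) univ_nonempty)
      (fun z => sum_pos (fun _ _ => hf _) univ_nonempty) ?_ ?_
    · intro x y
      -- Summing out one coordinate preserves log-supermodularity by the four functions theorem.
      refine four_functions_theorem_univ _ _ _ _ (fun _ => (hg _).le) (fun _ => (hg _).le)
        (fun _ => (hg _).le) (fun _ => (hg _).le) ?_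
      intro S T
      refine (hsup _ _).trans (le_of_eq ?_)
      congr 2 <;>
      · funext i
        refine Fin.cases ?_ (fun i => ?_) i <;> simp [Fin.consEquiv]
    · intro x
      -- With the other coordinates fixed, layer `i` of the sorted tuple supplies the two weights `a
      -- i` and `b i`, so domination survives the summation.
      have h := sum_le_prod_of_logSupermodular
        (fun S => g (Fin.consEquiv (fun _ => Finset (Fin k)) (S, x)))
        (fun i => f (Fin.consEquiv (fun _ => Bool)
          (false, fun u => decide ((i : ℕ) < (x u).card))))
        (fun i => f (Fin.consEquiv (fun _ => Bool)
          (true, fun u => decide ((i : ℕ) < (x u).card))))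
        (fun _ => hg _) (fun _ => hf _) (fun _ => hf _) ?_ ?_
      · refine h.trans (le_of_eq (prod_congr rfl fun i _ => ?_))
        rw [Fintype.sum_bool, add_comm]
      · intro S T
        refine (hsup _ _).trans (le_of_eq ?_)
        congr 2 <;>
        · funext i
          refine Fin.cases ?_ (fun i => ?_) i <;> simp [Fin.consEquiv]
      · intro S
        refine (hle _).trans (le_of_eq (prod_congr rfl fun i _ => ?_))
        split_ifs with hi <;>
        · refine congrArg f (funext fun j => ?_)
          refine Fin.cases ?_ (fun j => ?_) j <;> simp [Fin.consEquiv, hi]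

/-- The two-sided partition function of the bipartite multigraph in which the right vertex `v` is
joined to the left vertices `τ c v`; the right side is summed out. -/
noncomputable def leftPartition {n m Δ : ℕ} (τ : Fin Δ → Fin m → Fin n) (l₁ l₂ : ℝ) : ℝ :=
  ∑ A : Finset (Fin n), l₁ ^ A.card * ∏ v, (1 + l₂ * if ∀ c, τ c v ∉ A then 1 else 0)

/-- The weight of a left configuration in the `k`-fold cover of the multigraph `τ` with
permutation voltages `π`. -/
noncomputable def liftWeight {n m Δ k : ℕ} (τ : Fin Δ → Fin m → Fin n)
    (π : Fin m → Fin Δ → Equiv.Perm (Fin k)) (l₁ l₂ : ℝ) (x : Fin n → Finset (Fin k)) : ℝ :=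
  (∏ u, l₁ ^ (x u).card) *
    ∏ v, ∏ i, (1 + l₂ * if ∀ c, π v c i ∉ x (τ c v) then 1 else 0)

theorem one_add_ite_pos {l₂ : ℝ} (h₂ : 0 < l₂) (p : Prop) [Decidable p] :
    0 < 1 + l₂ * (if p then 1 else 0) := by
  split_ifs <;> linarith

/-- The activity factor is modular. For the factor of a right vertex, a neighbourhood free in `x` or
in `y` is free in `x ⊓ y`, and one free in both is also free in `x ⊔ y`. -/
theorem liftWeight_logSupermodular {n m Δ k : ℕ} (τ : Fin Δ → Fin m → Fin n)
    (π : Fin m → Fin Δ → Equiv.Perm (Fin k)) {l₁ l₂ : ℝ} (h₁ : 0 < l₁) (h₂ : 0 < l₂)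
    (x y : Fin n → Finset (Fin k)) :
    liftWeight τ π l₁ l₂ x * liftWeight τ π l₁ l₂ y ≤
      liftWeight τ π l₁ l₂ (x ⊓ y) * liftWeight τ π l₁ l₂ (x ⊔ y) := by
  unfold liftWeight
  rw [mul_mul_mul_comm, mul_mul_mul_comm (∏ u, l₁ ^ ((x ⊓ y) u).card)]
  refine mul_le_mul (le_of_eq ?_) ?_ ?_ ?_
  · rw [← prod_mul_distrib, ← prod_mul_distrib]
    refine prod_congr rfl fun u _ => ?_
    rw [← pow_add, ← pow_add]
    congr 1
    have := card_union_add_card_inter (x u) (y u)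
    simp only [Pi.inf_apply, Pi.sup_apply, inf_eq_inter, sup_eq_union]
    omega
  · rw [← prod_mul_distrib, ← prod_mul_distrib]
    refine prod_le_prod (fun v _ => mul_nonneg ?_ ?_) fun v _ => ?_
    · exact prod_nonneg fun i _ => (one_add_ite_pos h₂ _).le
    · exact prod_nonneg fun i _ => (one_add_ite_pos h₂ _).le
    rw [← prod_mul_distrib, ← prod_mul_distrib]
    refine prod_le_prod (fun i _ => mul_nonneg (one_add_ite_pos h₂ _).le
      (one_add_ite_pos h₂ _).le) fun i _ => ?_
    simp only [Pi.inf_apply, Pi.sup_apply, inf_eq_inter, sup_eq_union, mem_inter, mem_union]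
    by_cases hx : ∀ c, π v c i ∉ x (τ c v)
    · by_cases hy : ∀ c, π v c i ∉ y (τ c v)
      · simp [hx, hy]
      · rw [if_pos hx, if_neg hy, if_pos fun c h => hx c h.1]
        have := (one_add_ite_pos h₂ (∀ c, ¬(π v c i ∈ x (τ c v) ∨ π v c i ∈ y (τ c v)))).le
        have h4 : (1 : ℝ) ≤ 1 + l₂ * (if (∀ c, ¬(π v c i ∈ x (τ c v) ∨ π v c i ∈ y (τ c v)))
          then 1 else 0) := by split_ifs <;> linarith
        nlinarith
    · have h5 : ∀ p : Prop, ∀ [Decidable p], (1 : ℝ) ≤ 1 + l₂ * (if p then 1 else 0) := by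
        intro p _; split_ifs <;> linarith
      by_cases hy : ∀ c, π v c i ∉ y (τ c v)
      · rw [if_neg hx, if_pos hy, if_pos fun c h => hy c h.2]
        nlinarith [h5 (∀ c, ¬(π v c i ∈ x (τ c v) ∨ π v c i ∈ y (τ c v)))]
      · rw [if_neg hx, if_neg hy]
        simp only [mul_zero, add_zero, mul_one]
        exact one_le_mul_of_one_le_of_one_le (h5 _) (h5 _)
  · exact mul_nonneg (prod_nonneg fun _ _ => prod_nonneg fun _ _ => (one_add_ite_pos h₂ _).le)
      (prod_nonneg fun _ _ => prod_nonneg fun _ _ => (one_add_ite_pos h₂ _).le)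
  · exact mul_nonneg (prod_nonneg fun _ _ => by positivity)
      (prod_nonneg fun _ _ => by positivity)

theorem prod_one_add_ite {ι : Type*} [Fintype ι] (l : ℝ) (p : ι → Prop) [DecidablePred p] :
    ∏ i, (1 + l * if p i then 1 else 0) = (1 + l) ^ (univ.filter p).card := by
  rw [← prod_const, prod_filter]
  exact prod_congr rfl fun i _ => by split_ifs <;> simp

/-- Covers of a bipartite multigraph: the partition function of a `k`-fold cover is at most the
`k`-th power of the partition function of the base. -/
theorem sum_liftWeight_le {n m Δ k : ℕ} (hΔ : 0 < Δ) (τ : Fin Δ → Fin m → Fin n)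
    (π : Fin m → Fin Δ → Equiv.Perm (Fin k)) {l₁ l₂ : ℝ} (h₁ : 0 < l₁) (h₂ : 0 < l₂) :
    ∑ x, liftWeight τ π l₁ l₂ x ≤ leftPartition τ l₁ l₂ ^ k := by
  have hsum : leftPartition τ l₁ l₂ = ∑ z : Fin n → Bool,
      l₁ ^ (univ.filter fun u => z u = true).card *
        ∏ v, (1 + l₂ * if ∀ c, z (τ c v) = false then 1 else 0) := by
    unfold leftPartition
    refine Fintype.sum_equiv
      { toFun := fun A u => decide (u ∈ A)
        invFun := fun z => univ.filter fun u => z u = true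
        left_inv := fun A => by ext; simp
        right_inv := fun z => by ext; simp } _ _ fun A => ?_
    simp
  rw [hsum]
  refine sum_le_pow_of_logSupermodular _ _ ?_ ?_
    (liftWeight_logSupermodular τ π h₁ h₂) ?_
  · intro x
    exact mul_pos (prod_pos fun _ _ => by positivity)
      (prod_pos fun _ _ => prod_pos fun _ _ => one_add_ite_pos h₂ _)
  · intro z
    exact mul_pos (by positivity) (prod_pos fun _ _ => one_add_ite_pos h₂ _)
  · intro x
    rw [prod_mul_distrib]
    unfold liftWeight
    refine mul_le_mul (le_of_eq ?_) ?_ ?_ ?_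
    · rw [prod_pow_eq_pow_sum, prod_pow_eq_pow_sum]
      congr 1
      simp only [card_filter, decide_eq_true_eq]
      rw [sum_comm]
      refine sum_congr rfl fun u _ => ?_
      rw [← card_filter, Fin.card_filter_val_lt]
      have := card_le_univ (x u)
      simp at this
      omega
    · rw [prod_comm (s := univ) (t := univ) (f := fun (i : Fin k) (v : Fin m) => (1 + l₂ * if
        ∀ c, decide ((i : ℕ) < (x (τ c v)).card) = false then (1 : ℝ) else 0))]
      refine prod_le_prod (fun v _ => prod_nonneg fun i _ => (one_add_ite_pos h₂ _).le)
        fun v _ => ?_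
      rw [prod_one_add_ite, prod_one_add_ite]
      refine pow_le_pow_right₀ (by linarith) ?_
      have : Nonempty (Fin Δ) := ⟨⟨0, hΔ⟩⟩
      -- A neighbour with the fullest fibre decides: for sorted layers exactly `k` minus its size
      -- are free, while with arbitrary voltages this neighbour alone already allows no more.
      obtain ⟨c₀, hc₀⟩ := Finite.exists_max fun c : Fin Δ => (x (τ c v)).card
      have e1 : (univ.filter fun i : Fin k =>
          ∀ c, decide ((i : ℕ) < (x (τ c v)).card) = false) =
          (univ.filter fun i : Fin k => (i : ℕ) < (x (τ c₀ v)).card)ᶜ := by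
        ext i
        simp only [mem_filter, mem_univ, true_and, mem_compl, decide_eq_false_iff_not]
        exact ⟨fun h => h c₀, fun h c hc => h (hc.trans_le (hc₀ c))⟩
      have hk := card_le_univ (x (τ c₀ v))
      simp only [Fintype.card_fin] at hk
      rw [e1, card_compl, Fin.card_filter_val_lt, Fintype.card_fin, min_eq_right hk]
      calc (univ.filter fun i => ∀ c, π v c i ∉ x (τ c v)).card
          ≤ (univ.filter fun i => π v c₀ i ∈ (x (τ c₀ v))ᶜ).card := by
            refine card_le_card fun i hi => ?_
            simp only [mem_filter, mem_univ, true_and, mem_compl] at hi ⊢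
            exact hi c₀
        _ = k - (x (τ c₀ v)).card := by
            have : (univ.filter fun i => π v c₀ i ∈ (x (τ c₀ v))ᶜ)
                = ((x (τ c₀ v))ᶜ).map (π v c₀).symm.toEmbedding := by
              ext i; simp
            rw [this, card_map, card_compl, Fintype.card_fin]
    · exact prod_nonneg fun _ _ => prod_nonneg fun _ _ => (one_add_ite_pos h₂ _).le
    · exact prod_nonneg fun _ _ => by positivity

end Lift

/-! ### Averaging the cover inequality over random voltages. -/

section Averaging

open Finset

/-- The probability that a uniformly random permutation of `k` points maps a given set of `b`
points outside a given set of `a` points. -/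
noncomputable def avoidProb (k a b : ℕ) : ℝ := ((k - b).choose a : ℝ) / (k.choose a : ℝ)

theorem avoidProb_nonneg (k a b : ℕ) : 0 ≤ avoidProb k a b := by unfold avoidProb; positivity

theorem exists_perm_map_eq {k : ℕ} {A A' : Finset (Fin k)} (h : A.card = A'.card) :
    ∃ θ : Equiv.Perm (Fin k), ∀ i, θ i ∈ A' ↔ i ∈ A := by
  have e : {i // i ∈ A} ≃ {i // i ∈ A'} := Fintype.equivOfCardEq (by simpa using h)
  refine ⟨e.extendSubtype, fun i => ?_⟩
  constructor
  · intro hi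
    by_contra hcon
    exact e.extendSubtype_not_mem i hcon hi
  · exact fun hi => e.extendSubtype_mem i hi

/-- Double counting: the sum depends on `A` only through its size, so it may be averaged over all
sets of that size; for fixed `ρ` the admissible ones are the subsets of the complement of `ρ(B)`. -/
theorem sum_perm_avoid {k : ℕ} (A B : Finset (Fin k)) :
    ∑ ρ : Equiv.Perm (Fin k), (if ∀ i ∈ B, ρ i ∉ A then (1 : ℝ) else 0)
      = (k.factorial : ℝ) * avoidProb k A.card B.card := by
  have hconst : ∀ A' ∈ powersetCard A.card (univ : Finset (Fin k)),
      ∑ ρ : Equiv.Perm (Fin k), (if ∀ i ∈ B, ρ i ∉ A' then (1 : ℝ) else 0)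
        = ∑ ρ : Equiv.Perm (Fin k), (if ∀ i ∈ B, ρ i ∉ A then (1 : ℝ) else 0) := by
    intro A' hA'
    obtain ⟨θ, hθ⟩ := exists_perm_map_eq (mem_powersetCard.1 hA').2.symm
    rw [← Equiv.sum_comp (Equiv.mulLeft θ)]
    refine sum_congr rfl fun ρ _ => ?_
    simp [hθ]
  have hinner : ∀ ρ : Equiv.Perm (Fin k), ∑ A' ∈ powersetCard A.card (univ : Finset (Fin k)),
      (if ∀ i ∈ B, ρ i ∉ A' then (1 : ℝ) else 0) = ((k - B.card).choose A.card : ℝ) := by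
    intro ρ
    rw [← sum_filter, sum_const, nsmul_eq_mul, mul_one]
    congr 1
    have : (powersetCard A.card (univ : Finset (Fin k))).filter (fun A' => ∀ i ∈ B, ρ i ∉ A')
        = powersetCard A.card (B.map ρ.toEmbedding)ᶜ := by
      ext A'
      simp only [mem_filter, mem_powersetCard, subset_univ, true_and]
      rw [and_comm]
      refine and_congr_left fun _ => ?_
      constructor
      · intro h i hi
        simp only [mem_compl, mem_map, not_exists, not_and, Equiv.coe_toEmbedding]
        rintro j hj rfl
        exact h j hj hi
      · intro h i hi hi'
        have := h hi'
        simp only [mem_compl, mem_map, not_exists, not_and, Equiv.coe_toEmbedding] at this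
        exact this i hi rfl
    rw [this, card_powersetCard, card_compl, card_map, Fintype.card_fin]
  have hcomm := sum_comm (s := (univ : Finset (Equiv.Perm (Fin k))))
    (t := powersetCard A.card (univ : Finset (Fin k)))
    (f := fun ρ A' => if ∀ i ∈ B, ρ i ∉ A' then (1 : ℝ) else 0)
  rw [sum_congr rfl fun ρ _ => hinner ρ, sum_congr rfl hconst, sum_const, sum_const,
    card_powersetCard, card_univ, card_univ, Fintype.card_perm, Fintype.card_fin, nsmul_eq_mul,
    nsmul_eq_mul] at hcomm
  have hA : A.card ≤ k := by simpa using card_le_univ A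
  have hpos : (0 : ℝ) < (k.choose A.card : ℝ) := by exact_mod_cast Nat.choose_pos hA
  unfold avoidProb
  rw [← mul_div_assoc, eq_div_iff hpos.ne', hcomm]
  ring

theorem sum_prod_avoid {k Δ : ℕ} (A : Fin Δ → Finset (Fin k)) (B : Finset (Fin k)) :
    ∑ p : Fin Δ → Equiv.Perm (Fin k), ∏ c, (if ∀ i ∈ B, p c i ∉ A c then (1 : ℝ) else 0)
      = ∏ c, ((k.factorial : ℝ) * avoidProb k (A c).card B.card) := by
  rw [← Fintype.prod_sum fun c (ρ : Equiv.Perm (Fin k)) =>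
    if ∀ i ∈ B, ρ i ∉ A c then (1 : ℝ) else 0]
  exact prod_congr rfl fun c _ => sum_perm_avoid (A c) B

theorem prod_one_add_eq_sum {k Δ : ℕ} (l : ℝ) (A : Fin Δ → Finset (Fin k))
    (p : Fin Δ → Equiv.Perm (Fin k)) :
    ∏ i, (1 + l * if ∀ c, p c i ∉ A c then 1 else 0) =
      ∑ B : Finset (Fin k), l ^ B.card * ∏ c, (if ∀ i ∈ B, p c i ∉ A c then (1 : ℝ) else 0) := by
  rw [prod_one_add, powerset_univ]
  refine sum_congr rfl fun B _ => ?_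
  rw [prod_mul_distrib, prod_const, prod_ite_zero, prod_ite_zero, prod_const_one, prod_const_one]
  congr 2
  exact propext ⟨fun h c _ i hi => h i hi c, fun h i hi c => h c (mem_univ c) i hi⟩

/-- A lower bound for the partition function of an arbitrary bipartite multigraph, of the form of
the first moment of the partition function of a random cover. -/
theorem pow_le_leftPartition_pow {n m Δ k : ℕ} (hΔ : 0 < Δ) (τ : Fin Δ → Fin m → Fin n)
    {l₁ l₂ : ℝ} (h₁ : 0 < l₁) (h₂ : 0 < l₂) (a b : ℕ) :
    (l₁ ^ a * (k.choose a : ℝ)) ^ n * (l₂ ^ b * (k.choose b : ℝ) * avoidProb k a b ^ Δ) ^ m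
      ≤ leftPartition τ l₁ l₂ ^ k := by
  set X : Finset (Fin n → Finset (Fin k)) :=
    Fintype.piFinset fun _ => powersetCard a (univ : Finset (Fin k)) with hX
  set G : (Fin n → Finset (Fin k)) → Fin m → (Fin Δ → Equiv.Perm (Fin k)) → ℝ := fun x v p =>
    ∑ B ∈ powersetCard b (univ : Finset (Fin k)),
      l₂ ^ B.card * ∏ c, (if ∀ i ∈ B, p c i ∉ x (τ c v) then (1 : ℝ) else 0) with hG
  have hlow : ∀ π : Fin m → Fin Δ → Equiv.Perm (Fin k),
      ∑ x ∈ X, (l₁ ^ a) ^ n * ∏ v, G x v (π v) ≤ leftPartition τ l₁ l₂ ^ k := by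
    intro π
    refine le_trans ?_ (sum_liftWeight_le hΔ τ π h₁ h₂)
    refine le_trans (sum_le_sum (g := fun x => liftWeight τ π l₁ l₂ x) fun x hx => ?_)
      (sum_le_sum_of_subset_of_nonneg (subset_univ X) fun x _ _ => ?_)
    · unfold liftWeight
      have hx' : ∀ u, (x u).card = a := fun u =>
        (mem_powersetCard.1 (Fintype.mem_piFinset.1 hx u)).2
      simp only [hx', prod_const, card_univ, Fintype.card_fin]
      refine mul_le_mul_of_nonneg_left (prod_le_prod (fun v _ => ?_) fun v _ => ?_) (by positivity)
      · exact sum_nonneg fun B _ => mul_nonneg (by positivity)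
          (prod_nonneg fun c _ => by split_ifs <;> norm_num)
      · rw [prod_one_add_eq_sum l₂ (fun c => x (τ c v)) (π v)]
        exact sum_le_sum_of_subset_of_nonneg (subset_univ _) fun B _ _ =>
          mul_nonneg (by positivity) (prod_nonneg fun c _ => by split_ifs <;> norm_num)
    · exact mul_nonneg (prod_nonneg fun _ _ => by positivity)
        (prod_nonneg fun _ _ => prod_nonneg fun _ _ => (one_add_ite_pos h₂ _).le)
  have hGsum : ∀ x ∈ X, ∀ v, ∑ p, G x v p =
      (k.choose b : ℝ) * (l₂ ^ b * ((k.factorial : ℝ) * avoidProb k a b) ^ Δ) := by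
    intro x hx v
    have hx' : ∀ u, (x u).card = a := fun u =>
      (mem_powersetCard.1 (Fintype.mem_piFinset.1 hx u)).2
    simp only [hG]
    rw [sum_comm]
    rw [sum_congr rfl (g := fun _ => l₂ ^ b * ((k.factorial : ℝ) * avoidProb k a b) ^ Δ)]
    · rw [sum_const, card_powersetCard, card_univ, Fintype.card_fin, nsmul_eq_mul]
    · intro B hB
      rw [← mul_sum, sum_prod_avoid (fun c => x (τ c v)) B]
      simp only [hx', (mem_powersetCard.1 hB).2, prod_const, card_univ, Fintype.card_fin]
  -- The bound holds for every voltage assignment, hence for the average; there the factors of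
  -- distinct right vertices are independent.
  have havg := sum_le_sum fun π (_ : π ∈ univ) => hlow π
  rw [sum_comm] at havg
  have hX' : ∀ x ∈ X, ∑ π : Fin m → Fin Δ → Equiv.Perm (Fin k),
      (l₁ ^ a) ^ n * ∏ v, G x v (π v) = (l₁ ^ a) ^ n *
        ((k.choose b : ℝ) * (l₂ ^ b * ((k.factorial : ℝ) * avoidProb k a b) ^ Δ)) ^ m := by
    intro x hx
    rw [← mul_sum, ← Fintype.prod_sum fun v p => G x v p, prod_congr rfl fun v _ => hGsum x hx v]
    simp
  rw [sum_congr rfl hX', sum_const, sum_const, nsmul_eq_mul, nsmul_eq_mul, card_univ,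
    Fintype.card_pi_const, Fintype.card_pi_const, Fintype.card_perm, Fintype.card_fin, hX,
    Fintype.card_piFinset_const, card_powersetCard, card_univ, Fintype.card_fin] at havg
  have hfac : (0 : ℝ) < ((k.factorial ^ Δ) ^ m : ℕ) := by positivity
  refine le_of_mul_le_mul_left (le_trans (le_of_eq ?_) havg) hfac
  push_cast
  simp only [mul_pow]
  ring

end Averaging

/-! ### Expected number of independent pairs in the random graph. -/

section FirstMoment

open Finset

/-- The number of independent pairs `(A, B)`, `A` of size `a` on the left and `B` of size `b` on the right, of
the union of the matchings `σ`. -/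
noncomputable def pairCount {n Δ : ℕ} (σ : Fin Δ → Equiv.Perm (Fin n)) (a b : ℕ) : ℝ :=
  ∑ A ∈ powersetCard a (univ : Finset (Fin n)), ∑ B ∈ powersetCard b (univ : Finset (Fin n)),
    ∏ c, (if ∀ i ∈ B, (σ c).symm i ∉ A then (1 : ℝ) else 0)

theorem pairCount_nonneg {n Δ : ℕ} (σ : Fin Δ → Equiv.Perm (Fin n)) (a b : ℕ) :
    0 ≤ pairCount σ a b :=
  sum_nonneg fun _ _ => sum_nonneg fun _ _ => prod_nonneg fun _ _ => by split_ifs <;> norm_num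

theorem sum_pairCount (n Δ a b : ℕ) :
    ∑ σ : Fin Δ → Equiv.Perm (Fin n), pairCount σ a b = (n.factorial : ℝ) ^ Δ *
      ((n.choose a : ℝ) * (n.choose b : ℝ) * avoidProb n a b ^ Δ) := by
  unfold pairCount
  rw [sum_comm, sum_congr rfl (g := fun _ => (n.choose b : ℝ) *
    ((n.factorial : ℝ) * avoidProb n a b) ^ Δ)]
  · rw [sum_const, card_powersetCard, card_univ, Fintype.card_fin, nsmul_eq_mul, mul_pow]
    ring
  · intro A hA
    rw [sum_comm, sum_congr rfl (g := fun _ => ((n.factorial : ℝ) * avoidProb n a b) ^ Δ)]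
    · rw [sum_const, card_powersetCard, card_univ, Fintype.card_fin, nsmul_eq_mul]
    · intro B hB
      rw [← Equiv.sum_comp (Equiv.piCongrRight fun _ : Fin Δ => Equiv.inv (Equiv.Perm (Fin n)))]
      have := sum_prod_avoid (fun _ : Fin Δ => A) B
      simp only [(mem_powersetCard.1 hA).2, (mem_powersetCard.1 hB).2, prod_const, card_univ,
        Fintype.card_fin] at this
      rw [← this]
      refine sum_congr rfl fun σ _ => prod_congr rfl fun c _ => ?_
      simp only [Equiv.piCongrRight_apply, Pi.map_apply, Equiv.inv_apply]
      rfl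

theorem leftPartition_eq_sum_pairCount {n Δ : ℕ} (σ : Fin Δ → Equiv.Perm (Fin n)) (l₁ l₂ : ℝ) :
    leftPartition (fun c v => (σ c).symm v) l₁ l₂ =
      ∑ a ∈ range (n + 1), ∑ b ∈ range (n + 1), pairCount σ a b * (l₁ ^ a * l₂ ^ b) := by
  have hsplit : ∀ f : Finset (Fin n) → ℝ, ∑ A, f A =
      ∑ a ∈ range (n + 1), ∑ A ∈ powersetCard a (univ : Finset (Fin n)), f A := by
    intro f
    rw [← powerset_univ, sum_powerset]
    simp
  unfold leftPartition pairCount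
  rw [hsplit]
  refine sum_congr rfl fun a _ => ?_
  rw [sum_congr rfl (g := fun A => ∑ b ∈ range (n + 1),
    (∑ B ∈ powersetCard b (univ : Finset (Fin n)),
      ∏ c, (if ∀ i ∈ B, (σ c).symm i ∉ A then (1 : ℝ) else 0)) * (l₁ ^ a * l₂ ^ b))]
  · rw [sum_comm]
    exact sum_congr rfl fun b _ => (sum_mul _ _ _).symm
  · intro A hA
    rw [prod_one_add_eq_sum l₂ (fun _ => A) (fun c => (σ c).symm), hsplit, mul_sum,
      (mem_powersetCard.1 hA).2]
    refine sum_congr rfl fun b _ => ?_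
    rw [mul_sum, sum_mul]
    refine sum_congr rfl fun B hB => ?_
    rw [(mem_powersetCard.1 hB).2]
    ring

end FirstMoment

/-! ### Exponential growth rates via a crude Stirling formula. -/

section Entropy

open Filter Topology Real

theorem log_factorial_bounds (m : ℕ) : 0 ≤ log (m.factorial : ℝ) - (m * log m - m) ∧
    log (m.factorial : ℝ) - (m * log m - m) ≤ 1 + log m := by
  induction m with
  | zero => simp
  | succ m ih =>
    rcases Nat.eq_zero_or_pos m with rfl | hm
    · simp
    have hm' : (0 : ℝ) < m := by exact_mod_cast hm
    have e : log ((m + 1).factorial : ℝ) = log ((m : ℝ) + 1) + log (m.factorial : ℝ) := by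
      rw [Nat.factorial_succ]
      push_cast
      rw [log_mul (by positivity) (by positivity)]
    have h1 := one_sub_inv_le_log_of_pos (show 0 < ((m : ℝ) + 1) / m by positivity)
    have h2 := log_le_sub_one_of_pos (show 0 < ((m : ℝ) + 1) / m by positivity)
    rw [log_div (by positivity) (by positivity)] at h1 h2
    have h1' : (1 : ℝ) ≤ (m + 1) * (log (m + 1) - log m) := by
      have := mul_le_mul_of_nonneg_left h1 (show (0 : ℝ) ≤ m + 1 by positivity)
      have e2 : ((m : ℝ) + 1) * (1 - (((m : ℝ) + 1) / m)⁻¹) = 1 := by field_simp; ring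
      linarith
    have h2' : m * (log ((m : ℝ) + 1) - log m) ≤ 1 := by
      have := mul_le_mul_of_nonneg_left h2 hm'.le
      have e2 : (m : ℝ) * (((m : ℝ) + 1) / m - 1) = 1 := by field_simp; ring
      linarith
    rw [e]
    push_cast
    constructor <;> linarith [ih.1, ih.2]

theorem log_factorial_negMulLog {k m : ℕ} (hk : 0 < k) (hm : m ≤ k) :
    |log (m.factorial : ℝ) - (m * log k - k * negMulLog (m / k) - m)| ≤ 1 + log k := by
  have hk' : (0 : ℝ) < k := by exact_mod_cast hk
  have e : (m : ℝ) * log k - k * negMulLog (m / k) = m * log m := by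
    rcases Nat.eq_zero_or_pos m with rfl | hm0
    · simp
    have hm' : (0 : ℝ) < m := by exact_mod_cast hm0
    rw [negMulLog, log_div hm'.ne' hk'.ne']
    field_simp
    ring
  rw [e]
  obtain ⟨h1, h2⟩ := log_factorial_bounds m
  rw [abs_of_nonneg h1]
  refine h2.trans ?_
  rcases Nat.eq_zero_or_pos m with rfl | hm0
  · simp [log_natCast_nonneg]
  have hm' : (0 : ℝ) < m := by exact_mod_cast hm0
  have := log_le_log hm' (show (m : ℝ) ≤ k by exact_mod_cast hm)
  linarith

/-- The exponential growth rate of the expected number of independent pairs with densities `x` and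
`y` in the union of three random matchings. -/
noncomputable def entropyRate (x y : ℝ) : ℝ :=
  negMulLog x + negMulLog y + 3 * negMulLog (1 - x - y) - 2 * negMulLog (1 - x)
    - 2 * negMulLog (1 - y)

/-- The expected number of independent pairs with sizes `a` and `b` in the union of three random
matchings. -/
noncomputable def expectedPairs (k a b : ℕ) : ℝ :=
  (k.choose a : ℝ) * (k.choose b : ℝ) * avoidProb k a b ^ 3

theorem expectedPairs_pos {k a b : ℕ} (h : a + b ≤ k) : 0 < expectedPairs k a b := by
  have h1 : 0 < k.choose a := Nat.choose_pos (by omega)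
  have h2 : 0 < k.choose b := Nat.choose_pos (by omega)
  have h3 : 0 < (k - b).choose a := Nat.choose_pos (by omega)
  unfold expectedPairs avoidProb
  positivity

theorem expectedPairs_eq_zero {k a b : ℕ} (h : k < a + b) : expectedPairs k a b = 0 := by
  unfold expectedPairs avoidProb
  rcases lt_or_ge k b with hb | hb
  · rw [Nat.choose_eq_zero_of_lt hb]; simp
  · rw [Nat.choose_eq_zero_of_lt (show k - b < a by omega)]; simp

theorem log_choose {k a : ℕ} (h : a ≤ k) : log (k.choose a : ℝ) =
    log (k.factorial : ℝ) - log (a.factorial : ℝ) - log ((k - a).factorial : ℝ) := by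
  rw [Nat.cast_choose ℝ h, log_div (by positivity) (by positivity),
    log_mul (by positivity) (by positivity)]
  ring

/-- In the factorial expansion the linear terms and the multiples of `log k` cancel, leaving only
entropies. The factor `10` is the sum of the absolute coefficients `1 + 1 + 1 + 3 + 2 + 2` of the
log-factorials. -/
theorem log_expectedPairs {k a b : ℕ} (hk : 0 < k) (h : a + b ≤ k) :
    |log (expectedPairs k a b) - k * entropyRate (a / k) (b / k)| ≤ 10 * (1 + log k) := by
  have hk' : (0 : ℝ) < k := by exact_mod_cast hk
  have h1 : (0 : ℝ) < k.choose a := by exact_mod_cast Nat.choose_pos (by omega)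
  have h2 : (0 : ℝ) < k.choose b := by exact_mod_cast Nat.choose_pos (by omega)
  have h3 : (0 : ℝ) < (k - b).choose a := by exact_mod_cast Nat.choose_pos (by omega)
  have e : log (expectedPairs k a b) = - log (k.factorial : ℝ) - log (a.factorial : ℝ)
      - log (b.factorial : ℝ) - 3 * log ((k - b - a).factorial : ℝ)
      + 2 * log ((k - a).factorial : ℝ) + 2 * log ((k - b).factorial : ℝ) := by
    unfold expectedPairs avoidProb
    rw [log_mul (by positivity) (by positivity), log_mul (by positivity) (by positivity), log_pow,
      log_div (by positivity) (by positivity), log_choose (by omega), log_choose (by omega),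
      log_choose (by omega)]
    push_cast
    ring
  have b0 := abs_le.1 (log_factorial_negMulLog hk le_rfl)
  have b1 := abs_le.1 (log_factorial_negMulLog hk (show a ≤ k by omega))
  have b2 := abs_le.1 (log_factorial_negMulLog hk (show b ≤ k by omega))
  have b3 := abs_le.1 (log_factorial_negMulLog hk (show k - b - a ≤ k by omega))
  have b4 := abs_le.1 (log_factorial_negMulLog hk (show k - a ≤ k by omega))
  have b5 := abs_le.1 (log_factorial_negMulLog hk (show k - b ≤ k by omega))
  have c3 : ((k - b - a : ℕ) : ℝ) = k - b - a := by
    rw [Nat.cast_sub (by omega), Nat.cast_sub (by omega)]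
  have c4 : ((k - a : ℕ) : ℝ) = k - a := by rw [Nat.cast_sub (by omega)]
  have c5 : ((k - b : ℕ) : ℝ) = k - b := by rw [Nat.cast_sub (by omega)]
  rw [c3] at b3
  rw [c4] at b4
  rw [c5] at b5
  rw [div_self hk'.ne', negMulLog_one] at b0
  rw [show ((k : ℝ) - b - a) / k = 1 - a / k - b / k by field_simp; ring] at b3
  rw [show ((k : ℝ) - a) / k = 1 - a / k by field_simp] at b4
  rw [show ((k : ℝ) - b) / k = 1 - b / k by field_simp] at b5
  rw [e, entropyRate, abs_le]
  constructor <;> linarith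

theorem continuous_entropyRate : Continuous fun z : ℝ × ℝ => entropyRate z.1 z.2 := by
  unfold entropyRate
  have h := continuous_negMulLog
  exact (((((h.comp continuous_fst).add (h.comp continuous_snd)).add
    ((h.comp ((continuous_const.sub continuous_fst).sub continuous_snd)).const_mul 3)).sub
    ((h.comp (continuous_const.sub continuous_fst)).const_mul 2)).sub
    ((h.comp (continuous_const.sub continuous_snd)).const_mul 2))

theorem tendsto_entropyRate {x y : ℝ} {f g : ℕ → ℝ} (hf : Tendsto f atTop (𝓝 x))
    (hg : Tendsto g atTop (𝓝 y)) :
    Tendsto (fun k => entropyRate (f k) (g k)) atTop (𝓝 (entropyRate x y)) := by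
  have h1 : Tendsto (fun k => (f k, g k)) atTop (𝓝 (x, y)) := hf.prodMk_nhds hg
  have h2 : Tendsto (fun z : ℝ × ℝ => entropyRate z.1 z.2) (𝓝 (x, y)) (𝓝 (entropyRate x y)) :=
    continuous_entropyRate.tendsto' _ _ rfl
  have h3 := h2.comp h1
  simpa only [Function.comp_def] using h3

theorem log_expectedPairs_floor {x y : ℝ} (hx : 0 ≤ x) (hy : 0 ≤ y) (hxy : x + y ≤ 1) {k : ℕ}
    (hk : 0 < k) : |log (expectedPairs k ⌊x * k⌋₊ ⌊y * k⌋₊) / k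
      - entropyRate (⌊x * k⌋₊ / k) (⌊y * k⌋₊ / k)| ≤ 10 * (1 + log k) / k := by
  have hk' : (0 : ℝ) < k := by exact_mod_cast hk
  have hsum : ⌊x * k⌋₊ + ⌊y * k⌋₊ ≤ k := by
    have h1 := Nat.floor_le (mul_nonneg hx hk'.le)
    have h2 := Nat.floor_le (mul_nonneg hy hk'.le)
    have h3 : ((⌊x * k⌋₊ + ⌊y * k⌋₊ : ℕ) : ℝ) ≤ k := by
      push_cast
      nlinarith
    exact_mod_cast h3
  have := log_expectedPairs hk hsum
  generalize entropyRate (⌊x * k⌋₊ / k) (⌊y * k⌋₊ / k) = E at *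
  generalize log (expectedPairs k ⌊x * k⌋₊ ⌊y * k⌋₊) = F at *
  rw [show F / k - E = (F - k * E) / k by field_simp, abs_div, abs_of_pos hk']
  exact div_le_div_of_nonneg_right this hk'.le

theorem tendsto_log_div_natCast : Tendsto (fun k : ℕ => 10 * (1 + log k) / (k : ℝ)) atTop (𝓝 0) := by
  have h1 : Tendsto (fun k : ℕ => (k : ℝ)⁻¹) atTop (𝓝 0) := tendsto_inv_atTop_nhds_zero_nat
  have h3 : Tendsto (fun t : ℝ => log t / t) atTop (𝓝 0) :=
    isLittleO_log_id_atTop.tendsto_div_nhds_zero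
  have h2 : Tendsto (fun k : ℕ => log (k : ℝ) / k) atTop (𝓝 0) :=
    h3.comp tendsto_natCast_atTop_atTop
  have h4 := (h1.add h2).const_mul 10
  rw [add_zero, mul_zero] at h4
  refine h4.congr fun k => ?_
  ring

theorem tendsto_log_expectedPairs {x y : ℝ} (hx : 0 ≤ x) (hy : 0 ≤ y) (hxy : x + y ≤ 1) :
    Tendsto (fun k : ℕ => log (expectedPairs k ⌊x * k⌋₊ ⌊y * k⌋₊) / k) atTop
      (𝓝 (entropyRate x y)) := by
  have hfx : Tendsto (fun k : ℕ => (⌊x * k⌋₊ : ℝ) / k) atTop (𝓝 x) :=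
    (tendsto_nat_floor_mul_div_atTop hx).comp tendsto_natCast_atTop_atTop
  have hfy : Tendsto (fun k : ℕ => (⌊y * k⌋₊ : ℝ) / k) atTop (𝓝 y) :=
    (tendsto_nat_floor_mul_div_atTop hy).comp tendsto_natCast_atTop_atTop
  have hmain : Tendsto (fun k : ℕ => entropyRate (⌊x * k⌋₊ / k) (⌊y * k⌋₊ / k)) atTop
      (𝓝 (entropyRate x y)) := tendsto_entropyRate hfx hfy
  have hdiff : Tendsto (fun k : ℕ => log (expectedPairs k ⌊x * k⌋₊ ⌊y * k⌋₊) / k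
      - entropyRate (⌊x * k⌋₊ / k) (⌊y * k⌋₊ / k)) atTop (𝓝 0) := by
    refine squeeze_zero_norm' ((eventually_gt_atTop 0).mono fun k hk => ?_)
      tendsto_log_div_natCast
    rw [Real.norm_eq_abs]
    exact log_expectedPairs_floor hx hy hxy hk
  have h := hdiff.add hmain
  rw [zero_add] at h
  exact h.congr fun k => by ring

end Entropy

/-! ### Maximization of the free energy and loss of symmetry above the critical activity. -/

section FreeEnergy

open Filter Topology Real Set

/-- The exponential growth rate of the expected weight, at activity `lam`, of the independent sets
with densities `x` and `y` on the two sides. -/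
noncomputable def freeEnergy (lam x y : ℝ) : ℝ := (x + y) * log lam + entropyRate x y

theorem freeEnergy_comm (lam x y : ℝ) : freeEnergy lam x y = freeEnergy lam y x := by
  unfold freeEnergy entropyRate
  rw [show 1 - x - y = 1 - y - x by ring]
  ring

theorem continuous_freeEnergy (lam : ℝ) :
    Continuous fun z : ℝ × ℝ => freeEnergy lam z.1 z.2 := by
  unfold freeEnergy
  have := continuous_entropyRate
  fun_prop

/-- The region of feasible densities. -/
def densityRegion : Set (ℝ × ℝ) := {z | 0 ≤ z.1 ∧ 0 ≤ z.2 ∧ z.1 + z.2 ≤ 1}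

theorem isCompact_densityRegion : IsCompact densityRegion := by
  have hclosed : IsClosed densityRegion := by
    refine (isClosed_le continuous_const continuous_fst).inter
      ((isClosed_le continuous_const continuous_snd).inter
        (isClosed_le (continuous_fst.add continuous_snd) continuous_const))
  refine (isCompact_Icc (a := ((0 : ℝ), (0 : ℝ))) (b := (1, 1))).of_isClosed_subset hclosed ?_
  rintro ⟨x, y⟩ ⟨h1, h2, h3⟩
  simp only at h1 h2 h3
  exact ⟨⟨h1, h2⟩, ⟨by simp only; linarith, by simp only; linarith⟩⟩

theorem hasDerivAt_freeEnergy_diag (lam : ℝ) {p : ℝ} (h0 : 0 < p) (h1 : p < 1 / 2) :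
    HasDerivAt (fun t => freeEnergy lam t t)
      (2 * (log lam - log p + 3 * log (1 - p - p) - 2 * log (1 - p))) p := by
  have d1 := hasDerivAt_negMulLog h0.ne'
  have d2 := HasDerivAt.comp (h := fun t => 1 - t - t) p
    (hasDerivAt_negMulLog (show 1 - p - p ≠ 0 by linarith))
    (((hasDerivAt_id p).const_sub 1).sub (hasDerivAt_id p))
  have d3 := HasDerivAt.comp (h := fun t => 1 - t) p
    (hasDerivAt_negMulLog (show 1 - p ≠ 0 by linarith)) ((hasDerivAt_id p).const_sub 1)
  have := (((hasDerivAt_id p).add (hasDerivAt_id p)).mul_const (log lam)).add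
    ((((d1.add d1).add (d2.const_mul 3)).sub (d3.const_mul 2)).sub (d3.const_mul 2))
  refine HasDerivAt.congr_deriv (this.congr_of_eventuallyEq (Eventually.of_forall fun t => ?_)) ?_
  · simp [freeEnergy, entropyRate, Function.comp]
  · ring

theorem hasDerivAt_freeEnergy_antidiag (lam : ℝ) {p t : ℝ} (h0 : 0 < p) (h1 : p < 1 / 2)
    (ht0 : 0 ≤ t) (ht : t < p) :
    HasDerivAt (fun t => freeEnergy lam (p + t) (p - t))
      (log (p - t) - log (p + t) + 2 * log (1 - (p - t)) - 2 * log (1 - (p + t))) t := by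
  have i1 := (hasDerivAt_id t).const_add p
  have i2 := (hasDerivAt_id t).const_sub p
  have d1 := (hasDerivAt_negMulLog (show p + t ≠ 0 by linarith)).comp t i1
  have d2 := (hasDerivAt_negMulLog (show p - t ≠ 0 by linarith)).comp t i2
  have d3 := (hasDerivAt_negMulLog (show 1 - (p + t) ≠ 0 by linarith)).comp t (i1.const_sub 1)
  have d4 := (hasDerivAt_negMulLog (show 1 - (p - t) ≠ 0 by linarith)).comp t (i2.const_sub 1)
  have := (((d1.add d2).add_const (3 * negMulLog (1 - p - p))).sub (d3.const_mul 2)).sub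
    (d4.const_mul 2) |>.add_const ((p + p) * log lam)
  refine HasDerivAt.congr_deriv (this.congr_of_eventuallyEq (Eventually.of_forall fun s => ?_)) ?_
  · simp only [freeEnergy, entropyRate, Function.comp, Pi.add_apply, id]
    rw [show 1 - (p + s) - (p - s) = 1 - p - p by ring]
    simp
    ring
  · ring

/-- Above the critical activity no balanced density maximizes the free energy. -/
theorem exists_freeEnergy_gt {lam : ℝ} (hlam : 4 < lam) {p : ℝ} (hp0 : 0 ≤ p) (hp1 : p ≤ 1 / 2) :
    ∃ z ∈ densityRegion, freeEnergy lam p p < freeEnergy lam z.1 z.2 := by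
  have hl4 : log 4 < log lam := log_lt_log (by norm_num) hlam
  rcases hp0.eq_or_lt with rfl | hp0
  · refine ⟨(1 / 3, 1 / 3), ⟨by norm_num, by norm_num, by norm_num⟩, ?_⟩
    have e1 : (1 : ℝ) - 1 / 3 - 1 / 3 = 1 / 3 := by norm_num
    have e2 : (1 : ℝ) - 1 / 3 = 2 / 3 := by norm_num
    have e4 : log 4 = 2 * log 2 := by
      rw [show (4 : ℝ) = 2 ^ 2 by norm_num, log_pow]; norm_num
    have h34 : log 3 < log 4 := log_lt_log (by norm_num) (by norm_num)
    have h2 : 0 < log 2 := log_pos (by norm_num)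
    simp only [freeEnergy, entropyRate]
    rw [e1, e2]
    simp only [negMulLog]
    rw [log_div (by norm_num) (by norm_num), log_div (by norm_num) (by norm_num), log_one]
    simp
    linarith
  rcases hp1.eq_or_lt with rfl | hp1
  · refine ⟨(1, 0), ⟨by norm_num, by norm_num, by norm_num⟩, ?_⟩
    have h2 : 0 < log 2 := log_pos (by norm_num)
    have e1 : (1 : ℝ) - 1 / 2 - 1 / 2 = 0 := by norm_num
    have e2 : (1 : ℝ) - 1 / 2 = 1 / 2 := by norm_num
    simp only [freeEnergy, entropyRate]
    rw [e1, e2]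
    simp only [negMulLog]
    rw [log_div (by norm_num) (by norm_num), log_one]
    simp
    linarith
  by_contra! hcon
  have hlp : (0 : ℝ) < lam := by linarith
  have hq : 0 < 1 - p := by linarith
  have hr : 0 < 1 - p - p := by linarith
  have hmax : IsLocalMax (fun t => freeEnergy lam t t) p := by
    filter_upwards [Ioo_mem_nhds hp0 hp1] with t ht
    exact hcon (t, t) ⟨ht.1.le, ht.1.le, by simp only; linarith [ht.2]⟩
  have hd := hmax.hasDerivAt_eq_zero (hasDerivAt_freeEnergy_diag lam hp0 hp1)
  -- The critical-point equation along the diagonal. At activity `4` its solution is `p = 1 / 3`; a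
  -- larger activity pushes `p` above `1 / 3`.
  have heq : lam * (1 - p - p) ^ 3 = p * (1 - p) ^ 2 := by
    refine log_injOn_pos (mem_Ioi.2 (by positivity)) (mem_Ioi.2 (by positivity)) ?_
    rw [log_mul (by positivity) (by positivity), log_mul (by positivity) (by positivity), log_pow,
      log_pow]
    push_cast
    linarith
  have hp3 : 1 / 3 < p := by
    by_contra! hp3
    have h1 : 4 * (1 - p - p) ^ 3 < p * (1 - p) ^ 2 := by
      rw [← heq]
      exact mul_lt_mul_of_pos_right hlam (by positivity)
    -- This product is `4 (1 - 2p)^3 - p (1 - p)^2`; its quadratic factor has negative discriminant.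
    have h2 : 0 ≤ (1 - 3 * p) * (4 - 13 * p + 11 * p ^ 2) :=
      mul_nonneg (by linarith) (by nlinarith [sq_nonneg (p - 13 / 22)])
    nlinarith
  -- For `p > 1 / 3` the diagonal point can be improved along the antidiagonal: the difference of
  -- the arguments of the two logarithms below is `2t ((1 - p)(3p - 1) - t^2)`, positive for `0 < t
  -- < r` since `t^2 < t`.
  set r := min (p / 2) ((1 - p) * (3 * p - 1)) with hrdef
  have hr0 : 0 < r := lt_min (by linarith) (mul_pos hq (by linarith))
  have hrp : r < p := (min_le_left _ _).trans_lt (by linarith)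
  have hrq : r ≤ (1 - p) * (3 * p - 1) := min_le_right _ _
  have hmono : StrictMonoOn (fun t => freeEnergy lam (p + t) (p - t)) (Icc 0 r) := by
    refine strictMonoOn_of_deriv_pos (convex_Icc _ _) ?_ ?_
    · exact ((continuous_freeEnergy lam).comp
        ((continuous_const.add continuous_id).prodMk
          (continuous_const.sub continuous_id))).continuousOn
    · intro t ht
      rw [interior_Icc] at ht
      have htp : t < p := ht.2.trans hrp
      rw [(hasDerivAt_freeEnergy_antidiag lam hp0 hp1 ht.1.le htp).deriv]
      have a1 : 0 < p - t := by linarith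
      have a2 : 0 < p + t := by linarith [ht.1]
      have a3 : 0 < 1 - (p - t) := by linarith [ht.1]
      have a4 : 0 < 1 - (p + t) := by linarith
      have hlt : log ((p + t) * (1 - (p + t)) ^ 2) < log ((p - t) * (1 - (p - t)) ^ 2) := by
        refine log_lt_log (by positivity) ?_
        have h3 : t * t < (1 - p) * (3 * p - 1) := by nlinarith [ht.1, ht.2]
        have h4 := mul_pos ht.1 (sub_pos.2 h3)
        nlinarith
      rw [log_mul (by positivity) (by positivity), log_mul (by positivity) (by positivity),
        log_pow, log_pow] at hlt
      push_cast at hlt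
      linarith
  have h5 := hmono (left_mem_Icc.2 hr0.le) (right_mem_Icc.2 hr0.le) hr0
  have h6 := hcon (p + r, p - r) ⟨by simp only; linarith, by simp only; linarith,
    by simp only; linarith⟩
  simp only [add_zero, sub_zero] at h5 h6
  linarith

/-- Above the critical activity the free energy is maximal at an unbalanced pair of densities, and
stays away from its maximum near the balanced densities. -/
theorem exists_freeEnergy_gap {lam : ℝ} (hlam : 4 < lam) :
    ∃ δ ε x y : ℝ, 0 < δ ∧ δ ≤ 1 / 2 ∧ 0 < ε ∧ (x, y) ∈ densityRegion ∧ δ ≤ x - y ∧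
      (∀ z ∈ densityRegion, freeEnergy lam z.1 z.2 ≤ freeEnergy lam x y) ∧
      ∀ z ∈ densityRegion, |z.1 - z.2| ≤ δ →
        freeEnergy lam z.1 z.2 ≤ freeEnergy lam x y - 3 * ε := by
  have hcont := continuous_freeEnergy lam
  obtain ⟨⟨x, y⟩, hmem, hmax⟩ := isCompact_densityRegion.exists_isMaxOn
    ⟨(0, 0), by norm_num, by norm_num, by norm_num⟩ hcont.continuousOn
  obtain ⟨p, hp, hpmax⟩ := (isCompact_Icc (a := (0 : ℝ)) (b := 1 / 2)).exists_isMaxOn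
    ⟨0, by norm_num⟩ (f := fun t => freeEnergy lam t t)
    (hcont.comp (continuous_id.prodMk continuous_id)).continuousOn
  obtain ⟨w, hw, hwlt⟩ := exists_freeEnergy_gt hlam hp.1 hp.2
  have hmax' : ∀ z ∈ densityRegion, freeEnergy lam z.1 z.2 ≤ freeEnergy lam x y := hmax
  -- The gap to the diagonal maximum is `4 ε`; projecting a nearly balanced point to the diagonal
  -- costs at most `ε` by uniform continuity, leaving `3 ε`.
  set ε := (freeEnergy lam x y - freeEnergy lam p p) / 4 with hε
  have hεpos : 0 < ε := by have := hmax' w hw; simp only [hε]; linarith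
  have huc := isCompact_densityRegion.uniformContinuousOn_of_continuous hcont.continuousOn
  obtain ⟨η, hη, hclose⟩ := Metric.uniformContinuousOn_iff.1 huc ε hεpos
  set δ := min η (1 / 2) with hδ
  have hδpos : 0 < δ := lt_min hη (by norm_num)
  have hgap : ∀ z ∈ densityRegion, |z.1 - z.2| ≤ δ →
      freeEnergy lam z.1 z.2 ≤ freeEnergy lam x y - 3 * ε := by
    rintro ⟨u, v⟩ hz hzd
    obtain ⟨hu, hv, huv⟩ := hz
    simp only at hu hv huv hzd ⊢
    have hs : ((u + v) / 2, (u + v) / 2) ∈ densityRegion :=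
      ⟨by simp only; linarith, by simp only; linarith, by simp only; linarith⟩
    have hdist : dist (u, v) ((u + v) / 2, (u + v) / 2) < η := by
      have hδη : δ ≤ η := min_le_left _ _
      rw [Prod.dist_eq, max_lt_iff, Real.dist_eq, Real.dist_eq]
      obtain ⟨h1, h2⟩ := abs_le.1 hzd
      constructor <;> rw [abs_lt] <;> constructor <;> simp only <;> linarith
    have h1 := hclose (u, v) ⟨hu, hv, huv⟩ _ hs hdist
    rw [Real.dist_eq, abs_lt] at h1
    have h2 : freeEnergy lam ((u + v) / 2) ((u + v) / 2) ≤ freeEnergy lam p p :=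
      hpmax (show (u + v) / 2 ∈ Icc (0 : ℝ) (1 / 2) from ⟨by linarith, by linarith⟩)
    simp only at h1
    linarith [h1.2]
  have hδx : δ < |x - y| := by
    by_contra! hcon
    have := hgap (x, y) hmem hcon
    simp only at this
    linarith
  rcases le_total y x with hxy | hxy
  · refine ⟨δ, ε, x, y, hδpos, min_le_right _ _, hεpos, hmem, ?_, hmax', hgap⟩
    rw [abs_of_nonneg (by linarith)] at hδx
    exact hδx.le
  · refine ⟨δ, ε, y, x, hδpos, min_le_right _ _, hεpos, ⟨hmem.2.1, hmem.1, ?_⟩, ?_, ?_, ?_⟩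
    · have := hmem.2.2
      simp only at this ⊢
      linarith
    · rw [abs_of_nonpos (by linarith)] at hδx
      linarith
    · rw [freeEnergy_comm lam y x]; exact hmax'
    · rw [freeEnergy_comm lam y x]; exact hgap

end FreeEnergy

/-! ### Bethe lower bound, Markov upper bounds and tilting. -/

section Concentration

open Filter Topology Real Finset

theorem leftPartition_pos {n m Δ : ℕ} (τ : Fin Δ → Fin m → Fin n) {l₁ l₂ : ℝ} (h₁ : 0 < l₁)
    (h₂ : 0 < l₂) : 0 < leftPartition τ l₁ l₂ :=
  sum_pos (fun _ _ => mul_pos (by positivity) (prod_pos fun _ _ => one_add_ite_pos h₂ _))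
    univ_nonempty

/-- The Bethe lower bound for the partition function of a cubic bipartite multigraph. -/
theorem exp_le_leftPartition {n : ℕ} (τ : Fin 3 → Fin n → Fin n) {l₁ l₂ : ℝ} (h₁ : 0 < l₁)
    (h₂ : 0 < l₂) {x y : ℝ} (hxy : (x, y) ∈ densityRegion) :
    exp (n * (x * log l₁ + y * log l₂ + entropyRate x y)) ≤ leftPartition τ l₁ l₂ := by
  obtain ⟨hx, hy, hs⟩ := hxy
  simp only at hx hy hs
  have hZ := leftPartition_pos τ h₁ h₂
  rw [← le_log_iff_exp_le hZ]
  have hfx : Tendsto (fun k : ℕ => (⌊x * k⌋₊ : ℝ) / k) atTop (𝓝 x) :=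
    (tendsto_nat_floor_mul_div_atTop hx).comp tendsto_natCast_atTop_atTop
  have hfy : Tendsto (fun k : ℕ => (⌊y * k⌋₊ : ℝ) / k) atTop (𝓝 y) :=
    (tendsto_nat_floor_mul_div_atTop hy).comp tendsto_natCast_atTop_atTop
  have hlim := (((hfx.mul_const (log l₁)).add (hfy.mul_const (log l₂))).add
    (tendsto_log_expectedPairs hx hy hs)).const_mul (n : ℝ)
  -- The graph is fixed and only the degree `k` of the cover grows, so all Stirling errors vanish
  -- and the bound is exact in `n`.
  refine le_of_tendsto hlim ((eventually_gt_atTop 0).mono fun k hk => ?_)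
  have hk' : (0 : ℝ) < k := by exact_mod_cast hk
  have hsum : ⌊x * k⌋₊ + ⌊y * k⌋₊ ≤ k := by
    have e1 := Nat.floor_le (mul_nonneg hx hk'.le)
    have e2 := Nat.floor_le (mul_nonneg hy hk'.le)
    have e3 : ((⌊x * k⌋₊ + ⌊y * k⌋₊ : ℕ) : ℝ) ≤ k := by
      push_cast
      nlinarith
    exact_mod_cast e3
  generalize ⌊x * k⌋₊ = a at *
  generalize ⌊y * k⌋₊ = b at *
  have hE := expectedPairs_pos hsum
  have h := pow_le_leftPartition_pow (k := k) (by norm_num) τ h₁ h₂ a b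
  rw [← mul_pow, show l₁ ^ a * (k.choose a : ℝ) * (l₂ ^ b * (k.choose b : ℝ) * avoidProb k a b ^ 3)
    = l₁ ^ a * l₂ ^ b * expectedPairs k a b by unfold expectedPairs; ring] at h
  have h' := log_le_log (by positivity) h
  rw [log_pow, log_pow, log_mul (by positivity) hE.ne', log_mul (by positivity) (by positivity),
    log_pow, log_pow] at h'
  generalize log (expectedPairs k a b) = F at *
  rw [show (n : ℝ) * ((a : ℝ) / k * log l₁ + b / k * log l₂ + F / k)
    = (n * (a * log l₁ + b * log l₂ + F)) / k by field_simp, div_le_iff₀ hk']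
  linarith

open scoped Classical in
/-- The total weight, at activity `lam`, of the independent pairs whose sizes satisfy `P`. -/
noncomputable def weightOf {n Δ : ℕ} (σ : Fin Δ → Equiv.Perm (Fin n)) (lam : ℝ)
    (P : ℕ → ℕ → Prop) : ℝ :=
  ∑ a ∈ range (n + 1), ∑ b ∈ range (n + 1),
    if P a b then pairCount σ a b * lam ^ (a + b) else 0

theorem weightOf_nonneg {n Δ : ℕ} (σ : Fin Δ → Equiv.Perm (Fin n)) {lam : ℝ} (h : 0 < lam)
    (P : ℕ → ℕ → Prop) : 0 ≤ weightOf σ lam P :=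
  sum_nonneg fun a _ => sum_nonneg fun b _ => by
    split_ifs
    · exact mul_nonneg (pairCount_nonneg _ _ _) (by positivity)
    · exact le_rfl

-- There are at most `(n + 1) ^ 2` size pairs, and `10 * (1 + log n)` is the Stirling error. Pairs
-- with `a + b > n` have zero expectation, so `K` need only bound the feasible densities.
open scoped Classical in
theorem sum_weightOf_le {n : ℕ} (hn : 0 < n) {lam : ℝ} (hl : 0 < lam) (P : ℕ → ℕ → Prop) {K : ℝ}
    (hK : ∀ a b : ℕ, a + b ≤ n → P a b → freeEnergy lam (a / n) (b / n) ≤ K) :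
    ∑ σ : Fin 3 → Equiv.Perm (Fin n), weightOf σ lam P ≤
      (n.factorial : ℝ) ^ 3 * (((n : ℝ) + 1) ^ 2 * exp (n * K + 10 * (1 + log n))) := by
  have hn' : (0 : ℝ) < n := by exact_mod_cast hn
  unfold weightOf
  rw [sum_comm]
  simp_rw [sum_comm (s := (univ : Finset (Fin 3 → Equiv.Perm (Fin n))))]
  have hterm : ∀ a b : ℕ, (∑ σ : Fin 3 → Equiv.Perm (Fin n),
      if P a b then pairCount σ a b * lam ^ (a + b) else 0) ≤
        (n.factorial : ℝ) ^ 3 * exp (n * K + 10 * (1 + log n)) := by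
    intro a b
    by_cases hP : P a b
    · simp only [hP, if_true]
      rw [← sum_mul, sum_pairCount, mul_assoc]
      refine mul_le_mul_of_nonneg_left ?_ (by positivity)
      change expectedPairs n a b * lam ^ (a + b) ≤ _
      rcases le_or_gt (a + b) n with hab | hab
      · have hE := expectedPairs_pos hab
        rw [← log_le_iff_le_exp (by positivity), log_mul hE.ne' (by positivity), log_pow]
        have h1 := (abs_le.1 (log_expectedPairs hn hab)).2
        have h2 := mul_le_mul_of_nonneg_left (hK a b hab hP) hn'.le
        have h3 : (n : ℝ) * freeEnergy lam (a / n) (b / n) =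
            ((a + b : ℕ) : ℝ) * log lam + n * entropyRate (a / n) (b / n) := by
          unfold freeEnergy
          push_cast
          field_simp
        linarith
      · rw [expectedPairs_eq_zero hab, zero_mul]
        positivity
    · simp only [hP, if_false, sum_const_zero]
      positivity
  calc _ ≤ ∑ _a ∈ range (n + 1), ∑ _b ∈ range (n + 1),
        (n.factorial : ℝ) ^ 3 * exp (n * K + 10 * (1 + log n)) :=
        sum_le_sum fun a _ => sum_le_sum fun b _ => hterm a b
    _ = _ := by
        simp only [sum_const, card_range, nsmul_eq_mul]
        push_cast
        ring

/-- The bound on the failure probability given by Markov's inequality. -/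
noncomputable def tailBound (η : ℝ) (n : ℕ) : ℝ :=
  ((n : ℝ) + 1) ^ 2 * exp (10 * (1 + log n) - η * n)

theorem tendsto_tailBound {η : ℝ} (hη : 0 < η) : Tendsto (tailBound η) atTop (𝓝 0) := by
  -- The exponent `12` collects `(n + 1) ^ 2` and `exp (10 * log n)`.
  have h1 : Tendsto (fun t : ℝ => t ^ (12 : ℕ) * exp (-η * t)) atTop (𝓝 0) := by
    have := tendsto_rpow_mul_exp_neg_mul_atTop_nhds_zero 12 η hη
    refine this.congr fun t => ?_
    norm_cast
  have h2 : Tendsto (fun n : ℕ => 4 * exp 10 * ((n : ℝ) ^ (12 : ℕ) * exp (-η * n))) atTop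
      (𝓝 0) := by
    have := (h1.comp tendsto_natCast_atTop_atTop).const_mul (4 * exp 10)
    simpa only [Function.comp_def, mul_zero] using this
  refine squeeze_zero' (Eventually.of_forall fun n => by unfold tailBound; positivity)
    ((eventually_gt_atTop 0).mono fun n hn => ?_) h2
  have hn' : (1 : ℝ) ≤ n := by exact_mod_cast hn
  have e : exp (10 * (1 + log n) - η * n) = exp 10 * (n : ℝ) ^ 10 * exp (-η * n) := by
    rw [show 10 * (1 + log (n : ℝ)) - η * n = 10 + (10 : ℕ) * log n + -η * n by push_cast; ring,
      exp_add, exp_add, exp_nat_mul, exp_log (by linarith)]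
  unfold tailBound
  rw [e]
  have h3 : ((n : ℝ) + 1) ^ 2 ≤ 4 * (n : ℝ) ^ 2 := by nlinarith
  calc ((n : ℝ) + 1) ^ 2 * (exp 10 * (n : ℝ) ^ 10 * exp (-η * n))
      ≤ 4 * (n : ℝ) ^ 2 * (exp 10 * (n : ℝ) ^ 10 * exp (-η * n)) :=
        mul_le_mul_of_nonneg_right h3 (by positivity)
    _ = _ := by ring

-- Markov's inequality over the `n.factorial ^ 3` equally likely triples of matchings, with slack
-- `η` in the exponent.
open scoped Classical in
theorem card_weightOf_gt_le {n : ℕ} (hn : 0 < n) {lam : ℝ} (hl : 0 < lam) (P : ℕ → ℕ → Prop)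
    {K η : ℝ} (hK : ∀ a b : ℕ, a + b ≤ n → P a b → freeEnergy lam (a / n) (b / n) ≤ K) :
    ((univ.filter fun σ : Fin 3 → Equiv.Perm (Fin n) =>
      exp (n * (K + η)) < weightOf σ lam P).card : ℝ) ≤ (n.factorial : ℝ) ^ 3 * tailBound η n := by
  set B := univ.filter fun σ : Fin 3 → Equiv.Perm (Fin n) =>
    exp (n * (K + η)) < weightOf σ lam P
  have h1 : (B.card : ℝ) * exp (n * (K + η)) ≤ ∑ σ : Fin 3 → Equiv.Perm (Fin n),
      weightOf σ lam P := by
    rw [← nsmul_eq_mul, ← sum_const]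
    exact (sum_le_sum fun σ hσ => (mem_filter.1 hσ).2.le).trans
      (sum_le_sum_of_subset_of_nonneg (subset_univ B) fun σ _ _ => weightOf_nonneg σ hl P)
  have h2 := h1.trans (sum_weightOf_le hn hl P hK)
  have h3 : (n.factorial : ℝ) ^ 3 * tailBound η n * exp (n * (K + η)) =
      (n.factorial : ℝ) ^ 3 * (((n : ℝ) + 1) ^ 2 * exp (n * K + 10 * (1 + log n))) := by
    unfold tailBound
    rw [mul_assoc, mul_assoc, ← exp_add, show 10 * (1 + log (n : ℝ)) - η * n + n * (K + η)
      = n * K + 10 * (1 + log n) by ring]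
  rw [← h3] at h2
  exact le_of_mul_le_mul_right h2 (exp_pos _)

/-- If neither the total weight nor the weight of the balanced pairs is much larger than its
expectation, then the weight biased towards a side (`s = 1` for the left, `s = -1` for the right)
is exponentially larger than the balanced weight. -/
theorem weightOf_balanced_le {n : ℕ} (σ : Fin 3 → Equiv.Perm (Fin n)) {lam δ ε M : ℝ}
    (hl : 0 < lam) (hδ1 : δ ≤ 1 / 2) (hε : 0 < ε) {x y s : ℝ} (hs : s ^ 2 = 1)
    (hxy : (x, y) ∈ densityRegion) (hd : δ ≤ s * (x - y)) (hM : M ≤ freeEnergy lam x y)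
    (hn : 3 ≤ exp (δ * ε * n))
    (htot : weightOf σ lam (fun _ _ => True) ≤ exp (n * (M + δ * ε)))
    (hbal : weightOf σ lam (fun a b => (a : ℝ) ≤ b + δ * n ∧ (b : ℝ) ≤ a + δ * n) ≤
      exp (n * (M - 3 * ε + δ * ε))) :
    weightOf σ lam (fun a b => (a : ℝ) ≤ b + δ * n ∧ (b : ℝ) ≤ a + δ * n) ≤
      exp (-(ε * n)) * weightOf σ lam (fun a b => δ * n < s * ((a : ℝ) - b)) := by
  set L := weightOf σ lam (fun a b => δ * n < s * ((a : ℝ) - b)) with hL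
  set B := weightOf σ lam (fun a b => (a : ℝ) ≤ b + δ * n ∧ (b : ℝ) ≤ a + δ * n) with hB
  set T := weightOf σ lam (fun _ _ => True) with hT
  have hn0 : (0 : ℝ) ≤ n := Nat.cast_nonneg n
  have hs' : s = 1 ∨ s = -1 := by simpa using hs
  -- Bethe bound for the tilted activities: as `s * (x - y) ≥ δ`, the tilt raises the exponent by at
  -- least `δ * ε`.
  have hlow := exp_le_leftPartition (fun c v => (σ c).symm v) (show 0 < lam * exp (s * ε) by
    positivity) (show 0 < lam * exp (-(s * ε)) by positivity) hxy
  rw [log_mul hl.ne' (exp_pos _).ne', log_mul hl.ne' (exp_pos _).ne', log_exp, log_exp,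
    leftPartition_eq_sum_pairCount] at hlow
  have hlow' : exp (n * (M + δ * ε)) ≤
      exp (n * (x * (log lam + s * ε) + y * (log lam + -(s * ε)) + entropyRate x y)) := by
    refine exp_le_exp.2 (mul_le_mul_of_nonneg_left ?_ hn0)
    have := mul_le_mul_of_nonneg_right hd hε.le
    unfold freeEnergy at hM
    linarith
  -- The tilt multiplies a pair's weight by `exp (ε * s * (a - b))`, bounded separately on favoured,
  -- balanced and opposite pairs.
  have hup : ∑ a ∈ range (n + 1), ∑ b ∈ range (n + 1), pairCount σ a b *
      ((lam * exp (s * ε)) ^ a * (lam * exp (-(s * ε))) ^ b) ≤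
        exp (ε * n) * L + exp (δ * ε * n) * B + exp (-(δ * ε * n)) * T := by
    simp only [hL, hB, hT, weightOf, mul_sum, ← sum_add_distrib]
    refine sum_le_sum fun a ha => sum_le_sum fun b hb => ?_
    have ha' : (a : ℝ) ≤ n := by exact_mod_cast Nat.lt_succ_iff.1 (mem_range.1 ha)
    have hb' : (b : ℝ) ≤ n := by exact_mod_cast Nat.lt_succ_iff.1 (mem_range.1 hb)
    have ha0 : (0 : ℝ) ≤ a := Nat.cast_nonneg a
    have hb0 : (0 : ℝ) ≤ b := Nat.cast_nonneg b
    set w := pairCount σ a b * lam ^ (a + b) with hw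
    have hw0 : 0 ≤ w := mul_nonneg (pairCount_nonneg _ _ _) (by positivity)
    have e1 : pairCount σ a b * ((lam * exp (s * ε)) ^ a * (lam * exp (-(s * ε))) ^ b) =
        exp (ε * (s * (a - b))) * w := by
      rw [hw, mul_pow, mul_pow, ← exp_nat_mul, ← exp_nat_mul,
        show ε * (s * ((a : ℝ) - b)) = a * (s * ε) + b * -(s * ε) by ring, exp_add, pow_add]
      ring
    rw [e1]
    have hdn : s * ((a : ℝ) - b) ≤ n := by
      rcases hs' with rfl | rfl <;> linarith
    have hE1 : 0 ≤ exp (ε * n) * w := by positivity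
    have hE2 : 0 ≤ exp (δ * ε * n) * w := by positivity
    have hE3 : 0 ≤ exp (-(δ * ε * n)) * w := by positivity
    rw [if_pos trivial]
    by_cases c1 : δ * n < s * ((a : ℝ) - b)
    · have : exp (ε * (s * (a - b))) * w ≤ exp (ε * n) * w :=
        mul_le_mul_of_nonneg_right (exp_le_exp.2 (mul_le_mul_of_nonneg_left hdn hε.le)) hw0
      rw [if_pos c1]
      split_ifs <;> linarith
    · push Not at c1
      rw [if_neg (not_lt.2 c1)]
      by_cases c2 : (a : ℝ) ≤ b + δ * n ∧ (b : ℝ) ≤ a + δ * n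
      · have : exp (ε * (s * (a - b))) * w ≤ exp (δ * ε * n) * w := by
          refine mul_le_mul_of_nonneg_right (exp_le_exp.2 ?_) hw0
          have := mul_le_mul_of_nonneg_left c1 hε.le
          linarith
        rw [if_pos c2]
        linarith
      · have c3 : s * ((a : ℝ) - b) ≤ -(δ * n) := by
          rw [not_and_or, not_le, not_le] at c2
          rcases hs' with rfl | rfl <;> rcases c2 with c2 | c2 <;> linarith
        have : exp (ε * (s * (a - b))) * w ≤ exp (-(δ * ε * n)) * w := by
          refine mul_le_mul_of_nonneg_right (exp_le_exp.2 ?_) hw0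
          have := mul_le_mul_of_nonneg_left c3 hε.le
          linarith
        rw [if_neg c2]
        linarith
  have hmain := hlow'.trans (hlow.trans hup)
  have hδε : δ * ε ≤ 1 / 2 * ε := mul_le_mul_of_nonneg_right hδ1 hε.le
  have hb1 : exp (δ * ε * n) * B ≤ exp (n * M) := by
    refine (mul_le_mul_of_nonneg_left hbal (exp_pos _).le).trans ?_
    rw [← exp_add]
    refine exp_le_exp.2 ?_
    have : 0 ≤ n * (3 * ε - 2 * (δ * ε)) := mul_nonneg hn0 (by linarith)
    linarith
  have hb2 : exp (-(δ * ε * n)) * T ≤ exp (n * M) := by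
    refine (mul_le_mul_of_nonneg_left htot (exp_pos _).le).trans ?_
    rw [← exp_add]
    refine exp_le_exp.2 ?_
    linarith
  have hb3 : 3 * exp (n * M) ≤ exp (n * (M + δ * ε)) := by
    rw [show (n : ℝ) * (M + δ * ε) = δ * ε * n + n * M by ring, exp_add]
    exact mul_le_mul_of_nonneg_right hn (exp_pos _).le
  -- The balanced and opposite parts each contribute at most `exp (n * M)` to a sum of at least
  -- three times that, so the favoured part supplies the rest.
  have hLlow : exp (n * M) ≤ exp (ε * n) * L := by linarith
  have hLlow' : exp (-(ε * n)) * (exp (-(ε * n)) * exp (n * M)) ≤ exp (-(ε * n)) * L := by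
    refine mul_le_mul_of_nonneg_left ?_ (exp_pos _).le
    have := mul_le_mul_of_nonneg_left hLlow (exp_pos (-(ε * n))).le
    rwa [← mul_assoc, ← exp_add (-(ε * n)) (ε * n), neg_add_cancel, exp_zero, one_mul] at this
  refine hbal.trans (le_trans ?_ hLlow')
  rw [← exp_add, ← exp_add]
  refine exp_le_exp.2 ?_
  have : 0 ≤ n * (ε - δ * ε) := mul_nonneg hn0 (by linarith)
  linarith

end Concentration

/-! ### Counting criteria for asymptotically almost sure properties. -/

section AlmostSurely

open Filter Topology Finset

open scoped Classical in
theorem toOuterMeasure_randomGraph (n Δ : ℕ) (P : SimpleGraph (Fin n ⊕ Fin n) → Prop) :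
    (randomGraph n Δ).toOuterMeasure {G | P G} =
      ((univ.filter fun σ : Fin Δ → Equiv.Perm (Fin n) => P (unionOfMatchings σ)).card : ℝ≥0∞) /
        ((n.factorial ^ Δ : ℕ) : ℝ≥0∞) := by
  unfold randomGraph
  rw [PMF.toOuterMeasure_map_apply, PMF.toOuterMeasure_uniformOfFintype_apply,
    Fintype.card_pi_const, Fintype.card_perm, Fintype.card_fin, Fintype.card_subtype]
  rfl

open scoped Classical in
theorem AsymptoticallyAlmostSurely.mono {Δ : ℕ} {P Q : (n : ℕ) → SimpleGraph (Fin n ⊕ Fin n) → Prop}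
    (h : AsymptoticallyAlmostSurely Δ P) (hPQ : ∀ᶠ n in atTop, ∀ G, P n G → Q n G) :
    AsymptoticallyAlmostSurely Δ Q := by
  refine tendsto_of_tendsto_of_tendsto_of_le_of_le' h tendsto_const_nhds
    (hPQ.mono fun n hn => MeasureTheory.OuterMeasure.mono _ fun G hG => hn G hG)
    (Eventually.of_forall fun n => ?_)
  rw [toOuterMeasure_randomGraph, ENNReal.div_le_iff (by positivity) (by simp), one_mul]
  have : (univ.filter fun σ : Fin Δ → Equiv.Perm (Fin n) => Q n (unionOfMatchings σ)).card ≤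
      n.factorial ^ Δ := by
    refine (card_le_univ _).trans (le_of_eq ?_)
    rw [Fintype.card_pi_const, Fintype.card_perm, Fintype.card_fin]
  exact_mod_cast this

open scoped Classical in
theorem asymptoticallyAlmostSurely_of_card_le {Δ : ℕ}
    {P : (n : ℕ) → SimpleGraph (Fin n ⊕ Fin n) → Prop} {r : ℕ → ℝ} (hr : Tendsto r atTop (𝓝 0))
    (h : ∀ᶠ n in atTop, ((univ.filter fun σ : Fin Δ → Equiv.Perm (Fin n) =>
      ¬ P n (unionOfMatchings σ)).card : ℝ) ≤ (n.factorial : ℝ) ^ Δ * r n) :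
    AsymptoticallyAlmostSurely Δ P := by
  have hlim : Tendsto (fun n => ENNReal.ofReal (1 - r n)) atTop (𝓝 1) := by
    have := ENNReal.tendsto_ofReal (tendsto_const_nhds (x := (1 : ℝ)).sub hr)
    simpa using this
  have key : ∀ n, (univ.filter fun σ : Fin Δ → Equiv.Perm (Fin n) => P n (unionOfMatchings σ)).card
      + (univ.filter fun σ : Fin Δ → Equiv.Perm (Fin n) => ¬ P n (unionOfMatchings σ)).card
      = n.factorial ^ Δ := by
    intro n
    rw [card_filter_add_card_filter_not, card_univ, Fintype.card_pi_const,
      Fintype.card_perm, Fintype.card_fin]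
  refine tendsto_of_tendsto_of_tendsto_of_le_of_le' hlim tendsto_const_nhds (h.mono fun n hn => ?_)
    (Eventually.of_forall fun n => ?_)
  · rw [toOuterMeasure_randomGraph, ENNReal.le_div_iff_mul_le
      (Or.inl (by positivity)) (Or.inl (ENNReal.natCast_ne_top _))]
    have h1 := congrArg (Nat.cast (R := ℝ)) (key n)
    push_cast at h1
    have h2 : (1 - r n) * ((n.factorial ^ Δ : ℕ) : ℝ) ≤
        ((univ.filter fun σ : Fin Δ → Equiv.Perm (Fin n) => P n (unionOfMatchings σ)).card : ℝ) := by
      push_cast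
      linarith
    rw [← ENNReal.ofReal_natCast, ← ENNReal.ofReal_mul' (by positivity),
      ← ENNReal.ofReal_natCast]
    exact ENNReal.ofReal_le_ofReal h2
  · rw [toOuterMeasure_randomGraph, ENNReal.div_le_iff (by positivity) (by simp), one_mul]
    exact_mod_cast (Nat.le_add_right _ _).trans (key n).le

end AlmostSurely

/-! ### Gibbs probabilities as weighted counts of independent pairs. -/

section GibbsWeights

open Finset

theorem isIndepSet_disjSum_iff {n Δ : ℕ} (σ : Fin Δ → Equiv.Perm (Fin n)) (A B : Finset (Fin n)) :
    (unionOfMatchings σ).IsIndepSet ((A.disjSum B : Finset (Fin n ⊕ Fin n)) : Set (Fin n ⊕ Fin n)) ↔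
      ∀ c, ∀ i ∈ B, (σ c).symm i ∉ A := by
  constructor
  · intro h c i hi hA
    refine h (x := Sum.inl ((σ c).symm i)) (by simpa using hA) (y := Sum.inr i) (by simpa using hi)
      (by simp) ⟨c, (σ c).symm i, Or.inl ⟨rfl, by simp⟩⟩
  · rintro h x hx y hy - ⟨c, i, ⟨rfl, rfl⟩ | ⟨rfl, rfl⟩⟩
    · exact h c _ (by simpa using hy) (by simpa using hx)
    · exact h c _ (by simpa using hx) (by simpa using hy)

theorem partitionFunction_pos {V : Type*} [Fintype V] (G : SimpleGraph V)
    {lam : ℝ} (h : 0 < lam) : 0 < partitionFunction G lam :=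
  sum_pos (fun _ _ => by positivity) ⟨⟨∅, by simp⟩, mem_univ _⟩

theorem sum_finset_eq_sum_card {n : ℕ} (f : Finset (Fin n) → ℝ) : ∑ A, f A =
    ∑ a ∈ range (n + 1), ∑ A ∈ powersetCard a (univ : Finset (Fin n)), f A := by
  rw [← powerset_univ, sum_powerset]
  simp

open scoped Classical in
theorem partitionFunction_mul_gibbsProb {n Δ : ℕ} (σ : Fin Δ → Equiv.Perm (Fin n)) {lam : ℝ}
    (hl : 0 < lam) (P : ℕ → ℕ → Prop) (S : Set (IndepSet (unionOfMatchings σ)))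
    (hS : ∀ I, I ∈ S ↔ P (leftCard I.1) (rightCard I.1)) :
    partitionFunction (unionOfMatchings σ) lam * gibbsProb (unionOfMatchings σ) lam S =
      weightOf σ lam P := by
  have hZ := partitionFunction_pos (unionOfMatchings σ) hl
  unfold gibbsProb
  rw [mul_sum]
  have e1 : ∀ I : IndepSet (unionOfMatchings σ), partitionFunction (unionOfMatchings σ) lam *
      S.indicator (gibbs (unionOfMatchings σ) lam) I =
        if P I.1.toLeft.card I.1.toRight.card then lam ^ I.1.card else 0 := by
    intro I
    have hI : I ∈ S ↔ P I.1.toLeft.card I.1.toRight.card := hS I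
    by_cases h : I ∈ S
    · rw [Set.indicator_of_mem h, if_pos (hI.1 h), gibbs, mul_div_cancel₀ _ hZ.ne']
    · rw [Set.indicator_of_notMem h, mul_zero, if_neg fun h' => h (hI.2 h')]
  rw [sum_congr rfl fun I _ => e1 I]
  have e2 : ∑ I : IndepSet (unionOfMatchings σ),
      (if P I.1.toLeft.card I.1.toRight.card then lam ^ I.1.card else 0) =
      ∑ X : Finset (Fin n ⊕ Fin n),
        if (unionOfMatchings σ).IsIndepSet (X : Set (Fin n ⊕ Fin n)) then
          (if P X.toLeft.card X.toRight.card then lam ^ X.card else 0) else 0 := by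
    refine Eq.trans ?_ (sum_filter _ _)
    exact (sum_subtype (univ.filter fun X : Finset (Fin n ⊕ Fin n) =>
        (unionOfMatchings σ).IsIndepSet (X : Set (Fin n ⊕ Fin n)))
      (p := fun X : Finset (Fin n ⊕ Fin n) =>
        (unionOfMatchings σ).IsIndepSet (X : Set (Fin n ⊕ Fin n))) (fun X => by simp)
      fun X : Finset (Fin n ⊕ Fin n) =>
        if P X.toLeft.card X.toRight.card then lam ^ X.card else 0).symm
  rw [e2, ← Equiv.sum_comp (sumEquiv (α := Fin n) (β := Fin n)).symm.toEquiv,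
    Fintype.sum_prod_type]
  unfold weightOf
  rw [sum_finset_eq_sum_card]
  refine sum_congr rfl fun a _ => ?_
  rw [sum_congr rfl fun A _ => sum_finset_eq_sum_card _, sum_comm]
  refine sum_congr rfl fun b _ => ?_
  have e3 : ∀ A ∈ powersetCard a (univ : Finset (Fin n)),
      ∀ B ∈ powersetCard b (univ : Finset (Fin n)),
      (if (unionOfMatchings σ).IsIndepSet
          ((A.disjSum B : Finset (Fin n ⊕ Fin n)) : Set (Fin n ⊕ Fin n)) then
        (if P (A.disjSum B).toLeft.card (A.disjSum B).toRight.card then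
          lam ^ (A.disjSum B).card else 0) else 0) =
      (if P a b then lam ^ (a + b) else 0) *
        ∏ c, (if ∀ i ∈ B, (σ c).symm i ∉ A then (1 : ℝ) else 0) := by
    intro A hA B hB
    rw [toLeft_disjSum, toRight_disjSum, card_disjSum, (mem_powersetCard.1 hA).2,
      (mem_powersetCard.1 hB).2, prod_ite_zero, prod_const_one]
    simp only [isIndepSet_disjSum_iff, mem_univ, true_implies]
    split_ifs <;> simp
  refine (sum_congr rfl fun A hA => sum_congr rfl fun B hB => e3 A hA B hB).trans ?_
  simp only [← mul_sum]
  unfold pairCount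
  split_ifs <;> ring

end GibbsWeights

/-! ### Bottleneck bound for a general stationary chain. -/

section Bottleneck

open Finset

/-- A stationary chain which starts in `L` and is in `R` at time `t` has visited `B` in between. -/
theorem sum_pow_le_of_separated {α : Type*} [Fintype α] [DecidableEq α] (K : Matrix α α ℝ)
    (μ : α → ℝ) (hK0 : ∀ i j, 0 ≤ K i j) (hK1 : ∀ i, ∑ j, K i j = 1) (hμ0 : ∀ i, 0 ≤ μ i)
    (hstat : ∀ j, ∑ i, μ i * K i j = μ j) (L B R : Finset α) (hcov : ∀ i, i ∈ L ∨ i ∈ B ∨ i ∈ R)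
    (hLR : Disjoint L R) (hsep : ∀ i ∈ L, ∀ j ∈ R, K i j = 0) (t : ℕ) :
    ∑ i ∈ L, μ i * ∑ j ∈ R, (K ^ t) i j ≤ t * ∑ i ∈ B, μ i := by
  have hpow : ∀ t : ℕ, (∀ i j, 0 ≤ (K ^ t) i j) ∧ ∀ i, ∑ j, (K ^ t) i j = 1 := by
    intro t
    induction t with
    | zero =>
      refine ⟨fun i j => ?_, fun i => ?_⟩
      · rw [pow_zero, Matrix.one_apply]; split_ifs <;> norm_num
      · simp [Matrix.one_apply]
    | succ t ih =>
      refine ⟨fun i j => ?_, fun i => ?_⟩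
      · rw [pow_succ', Matrix.mul_apply]
        exact sum_nonneg fun m _ => mul_nonneg (hK0 _ _) (ih.1 _ _)
      · simp only [pow_succ', Matrix.mul_apply]
        rw [sum_comm]
        simp only [← mul_sum, ih.2, mul_one, hK1]
  induction t with
  | zero =>
    simp only [pow_zero, Nat.cast_zero, zero_mul]
    refine le_of_eq (sum_eq_zero fun i hi => ?_)
    rw [sum_eq_zero fun j hj => ?_, mul_zero]
    rw [Matrix.one_apply, if_neg]
    rintro rfl
    exact disjoint_left.1 hLR hi hj
  | succ t ih =>
    set u : α → ℝ := fun m => ∑ j ∈ R, (K ^ t) m j with hu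
    have hu0 : ∀ m, 0 ≤ u m := fun m => sum_nonneg fun j _ => (hpow t).1 m j
    have hu1 : ∀ m, u m ≤ 1 := fun m => by
      rw [← (hpow t).2 m]
      exact sum_le_sum_of_subset_of_nonneg (subset_univ _) fun j _ _ => (hpow t).1 m j
    have e : ∑ i ∈ L, μ i * ∑ j ∈ R, (K ^ (t + 1)) i j =
        ∑ m, (∑ i ∈ L, μ i * K i m) * u m := by
      simp only [pow_succ', Matrix.mul_apply, hu, sum_mul]
      rw [sum_comm]
      refine sum_congr rfl fun i _ => ?_
      rw [sum_comm, mul_sum]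
      refine sum_congr rfl fun m _ => ?_
      rw [mul_sum, mul_sum]
      exact sum_congr rfl fun j _ => by ring
    have hc : ∀ m, ∑ i ∈ L, μ i * K i m ≤ μ m := fun m => by
      rw [← hstat m]
      exact sum_le_sum_of_subset_of_nonneg (subset_univ _) fun i _ _ =>
        mul_nonneg (hμ0 i) (hK0 i m)
    -- Split at the first step from `L`: staying in `L` gives the induction hypothesis, entering `B`
    -- costs at most its mass, and jumping to `R` is impossible.
    have hterm : ∀ m, (∑ i ∈ L, μ i * K i m) * u m ≤
        (if m ∈ L then μ m * u m else 0) + if m ∈ B then μ m else 0 := by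
      intro m
      have h1 : 0 ≤ μ m * u m := mul_nonneg (hμ0 m) (hu0 m)
      have h2 := mul_le_mul_of_nonneg_right (hc m) (hu0 m)
      have h3 := mul_le_mul_of_nonneg_left (hu1 m) (hμ0 m)
      rw [mul_one] at h3
      have h4 := hμ0 m
      rcases hcov m with hm | hm | hm
      · rw [if_pos hm]
        split_ifs <;> linarith
      · rw [if_pos hm]
        split_ifs <;> linarith
      · rw [sum_eq_zero fun i hi => by rw [hsep i hi m hm, mul_zero], zero_mul]
        split_ifs <;> linarith
    rw [e]
    refine (sum_le_sum fun m _ => hterm m).trans ?_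
    rw [sum_add_distrib, ← sum_filter, ← sum_filter, filter_univ_mem, filter_univ_mem]
    push_cast
    linarith

theorem sum_sub_le_tvDist {α : Type*} [Fintype α] (p q : α → ℝ) (h : ∑ i, p i = ∑ i, q i)
    (R : Finset α) : ∑ i ∈ R, q i - ∑ i ∈ R, p i ≤ tvDist p q := by
  classical
  unfold tvDist
  have hp := sum_add_sum_compl R p
  have hq := sum_add_sum_compl R q
  have habs := sum_add_sum_compl R fun i => |p i - q i|
  have h1 : ∑ i ∈ R, (q i - p i) ≤ ∑ i ∈ R, |p i - q i| :=
    sum_le_sum fun i _ => by rw [abs_sub_comm]; exact le_abs_self _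
  have h2 : ∑ i ∈ Rᶜ, (p i - q i) ≤ ∑ i ∈ Rᶜ, |p i - q i| :=
    sum_le_sum fun i _ => le_abs_self _
  rw [sum_sub_distrib] at h1 h2
  linarith

/-- If two sets of states are separated by a set `B` of small mass, and the target one has mass at
least `3 / 8`, then the chain cannot mix fast. -/
theorem mass_le_of_tvDist_le {α : Type*} [Fintype α] [DecidableEq α] (K : Matrix α α ℝ)
    (μ : α → ℝ) (hK0 : ∀ i j, 0 ≤ K i j) (hK1 : ∀ i, ∑ j, K i j = 1) (hμ0 : ∀ i, 0 ≤ μ i)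
    (hμ1 : ∑ i, μ i = 1) (hstat : ∀ j, ∑ i, μ i * K i j = μ j) (L B R : Finset α)
    (hcov : ∀ i, i ∈ L ∨ i ∈ B ∨ i ∈ R) (hLR : Disjoint L R)
    (hsep : ∀ i ∈ L, ∀ j ∈ R, K i j = 0) (hR : 3 / 8 ≤ ∑ i ∈ R, μ i) (t : ℕ)
    (hmix : ∀ i, tvDist ((K ^ t) i) μ ≤ 1 / 4) :
    1 / 8 * ∑ i ∈ L, μ i ≤ t * ∑ i ∈ B, μ i := by
  refine le_trans ?_ (sum_pow_le_of_separated K μ hK0 hK1 hμ0 hstat L B R hcov hLR hsep t)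
  have hrow : ∀ i, ∑ j, (K ^ t) i j = 1 := by
    clear hmix
    induction t with
    | zero => intro i; simp [Matrix.one_apply]
    | succ t ih =>
      intro i
      simp only [pow_succ', Matrix.mul_apply]
      rw [sum_comm]
      simp only [← mul_sum, ih, mul_one, hK1]
  rw [mul_sum]
  refine sum_le_sum fun i _ => ?_
  rw [mul_comm]
  refine mul_le_mul_of_nonneg_left ?_ (hμ0 i)
  -- From every start the mass of `R` at time `t` is at least `3 / 8 - 1 / 4 = 1 / 8`.
  have := sum_sub_le_tvDist ((K ^ t) i) μ (by rw [hrow, hμ1]) R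
  linarith [hmix i]

end Bottleneck

/-! ### Reversibility and locality of the Glauber dynamics. -/

section Glauber

open Finset

variable {V : Type*} {G : SimpleGraph V} {lam : ℝ}

theorem acceptMove_insert_eq_iff [DecidableEq V] {I J : IndepSet G} (hIJ : I ≠ J) (v : V) :
    acceptMove I (insert v I.1) = J ↔ v ∉ I.1 ∧ J.1 = insert v I.1 := by
  unfold acceptMove
  constructor
  · intro h
    split_ifs at h with h'
    · refine ⟨fun hv => hIJ ?_, by rw [← h]⟩
      rw [← h]
      exact Subtype.ext (insert_eq_self.2 hv).symm
    · exact absurd h hIJ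
  · rintro ⟨_, h⟩
    have h' : G.IsIndepSet ((insert v I.1 : Finset V) : Set V) := by rw [← h]; exact J.2
    rw [dif_pos h']
    exact Subtype.ext h.symm

theorem acceptMove_erase_eq_iff [DecidableEq V] {I J : IndepSet G} (hIJ : I ≠ J) (v : V) :
    acceptMove I (I.1.erase v) = J ↔ v ∉ J.1 ∧ I.1 = insert v J.1 := by
  have hind : G.IsIndepSet ((I.1.erase v : Finset V) : Set V) := by
    intro x hx y hy
    exact I.2 (mem_of_mem_erase (mem_coe.1 hx)) (mem_of_mem_erase (mem_coe.1 hy))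
  unfold acceptMove
  rw [dif_pos hind]
  constructor
  · rintro rfl
    refine ⟨notMem_erase v _, ?_⟩
    by_cases hv : v ∈ I.1
    · exact (insert_erase hv).symm
    · exact absurd (Subtype.ext (erase_eq_of_notMem hv).symm) hIJ
  · rintro ⟨hv, h⟩
    refine Subtype.ext ?_
    simp only [h, erase_insert hv]

theorem glauber_nonneg [Fintype V] [DecidableEq V] (hl : 0 < lam) (I J : IndepSet G) : 0 ≤ glauber G lam I J := by
  unfold glauber
  refine mul_nonneg (by positivity) (sum_nonneg fun v _ => ?_)
  split_ifs <;> positivity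

theorem glauber_row_sum [Fintype V] [DecidableEq V] [Nonempty V] (hl : 0 < lam) (I : IndepSet G) :
    ∑ J, glauber G lam I J = 1 := by
  unfold glauber
  rw [← mul_sum, sum_comm]
  simp only [sum_add_distrib, ← mul_sum, sum_ite_eq, mem_univ, if_true, sum_const, card_univ,
    nsmul_eq_mul, mul_one]
  have h1 : (Fintype.card V : ℝ) ≠ 0 := by exact_mod_cast Fintype.card_ne_zero
  have h2 : 1 + lam ≠ 0 := by positivity
  field_simp
  ring

/-- For `I ≠ J`, inserting `v` leads from `I` to `J` exactly when erasing `v` leads back, and the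
ratio `lam` of the two proposal probabilities matches the ratio of the weights. -/
theorem glauber_detailed_balance [Fintype V] [DecidableEq V] (I J : IndepSet G) :
    lam ^ I.1.card * glauber G lam I J = lam ^ J.1.card * glauber G lam J I := by
  by_cases hIJ : I = J
  · rw [hIJ]
  unfold glauber
  rw [mul_left_comm, mul_left_comm (lam ^ J.1.card)]
  refine congrArg _ ?_
  rw [mul_sum, mul_sum]
  refine sum_congr rfl fun v _ => ?_
  have h1 := acceptMove_insert_eq_iff hIJ v
  have h2 := acceptMove_erase_eq_iff hIJ v
  have h3 := acceptMove_insert_eq_iff (Ne.symm hIJ) v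
  have h4 := acceptMove_erase_eq_iff (Ne.symm hIJ) v
  by_cases c1 : v ∉ I.1 ∧ J.1 = insert v I.1
  · have c2 : ¬ (v ∉ J.1 ∧ I.1 = insert v J.1) := fun h => h.1 (by rw [c1.2]; simp)
    rw [if_pos (h1.2 c1), if_neg fun h => c2 (h2.1 h), if_neg fun h => c2 (h3.1 h),
      if_pos (h4.2 c1), c1.2, card_insert_of_notMem c1.1, pow_succ]
    ring
  · rw [if_neg fun h => c1 (h1.1 h), if_neg fun h => c1 (h4.1 h)]
    by_cases c2 : v ∉ J.1 ∧ I.1 = insert v J.1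
    · rw [if_pos (h2.2 c2), if_pos (h3.2 c2), c2.2, card_insert_of_notMem c2.1, pow_succ]
      ring
    · rw [if_neg fun h => c2 (h2.1 h), if_neg fun h => c2 (h3.1 h)]
      ring

theorem gibbs_stationary [Fintype V] [DecidableEq V] [Nonempty V] (hl : 0 < lam) (J : IndepSet G) :
    ∑ I, gibbs G lam I * glauber G lam I J = gibbs G lam J := by
  have h : ∀ I, gibbs G lam I * glauber G lam I J = gibbs G lam J * glauber G lam J I := by
    intro I
    unfold gibbs
    rw [div_mul_eq_mul_div, div_mul_eq_mul_div, glauber_detailed_balance]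
  rw [sum_congr rfl fun I _ => h I, ← mul_sum, glauber_row_sum hl, mul_one]

theorem glauber_eq_zero [Fintype V] [DecidableEq V] {I J : IndepSet G} (hIJ : I ≠ J)
    (h1 : ∀ v, v ∉ I.1 → J.1 ≠ insert v I.1) (h2 : ∀ v, v ∉ J.1 → I.1 ≠ insert v J.1) :
    glauber G lam I J = 0 := by
  unfold glauber
  refine mul_eq_zero_of_right _ (sum_eq_zero fun v _ => ?_)
  rw [if_neg fun h => h1 v ((acceptMove_insert_eq_iff hIJ v).1 h).1
      ((acceptMove_insert_eq_iff hIJ v).1 h).2,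
    if_neg fun h => h2 v ((acceptMove_erase_eq_iff hIJ v).1 h).1
      ((acceptMove_erase_eq_iff hIJ v).1 h).2]
  ring

theorem gibbs_nonneg [Fintype V] (hl : 0 < lam) (I : IndepSet G) : 0 ≤ gibbs G lam I :=
  div_nonneg (by positivity) (partitionFunction_pos G hl).le

theorem sum_gibbs [Fintype V] (hl : 0 < lam) : ∑ I, gibbs G lam I = 1 := by
  unfold gibbs
  rw [← sum_div]
  exact div_self (partitionFunction_pos G hl).ne'

open scoped Classical in
theorem gibbsProb_eq_sum [Fintype V] (S : Set (IndepSet G)) :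
    gibbsProb G lam S = ∑ I ∈ univ.filter (· ∈ S), gibbs G lam I := by
  unfold gibbsProb
  rw [sum_filter]
  exact sum_congr rfl fun I _ => by rw [Set.indicator_apply]

end Glauber

/-! ### The balanced sets as a bottleneck for the Glauber dynamics. -/

section Torpid

open Finset

variable {n : ℕ} {G : SimpleGraph (Fin n ⊕ Fin n)} {lam δ : ℝ}

theorem card_insert_bounds {X Y : Finset (Fin n ⊕ Fin n)} {v : Fin n ⊕ Fin n} (hv : v ∉ X)
    (h : Y = insert v X) : leftCard X ≤ leftCard Y ∧ rightCard X ≤ rightCard Y ∧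
      leftCard Y + rightCard Y = leftCard X + rightCard X + 1 := by
  unfold leftCard rightCard
  have hsub : X ⊆ Y := by rw [h]; exact subset_insert v X
  refine ⟨card_le_card fun i hi => ?_, card_le_card fun i hi => ?_, ?_⟩
  · rw [mem_toLeft] at hi ⊢; exact hsub hi
  · rw [mem_toRight] at hi ⊢; exact hsub hi
  · rw [card_toLeft_add_card_toRight, card_toLeft_add_card_toRight, h, card_insert_of_notMem hv]

/-- One update changes the difference of the two side counts by at most one, whereas crossing
between the biased classes changes it by more than `2 * δ * n`. -/
theorem glauber_left_right_eq_zero (hδ : 1 ≤ 2 * (δ * n)) {I J : IndepSet G}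
    (hI : I ∈ biasedLeft G δ) (hJ : J ∈ biasedRight G δ) :
    glauber G lam I J = 0 ∧ glauber G lam J I = 0 := by
  have hI : (rightCard I.1 : ℝ) + δ * n < leftCard I.1 := hI
  have hJ : (leftCard J.1 : ℝ) + δ * n < rightCard J.1 := hJ
  have hne : I ≠ J := by rintro rfl; linarith
  have key1 : ∀ v, v ∉ I.1 → J.1 ≠ insert v I.1 := by
    intro v hv h
    obtain ⟨h1, h2, h3⟩ := card_insert_bounds hv h
    have h1 : (leftCard I.1 : ℝ) ≤ leftCard J.1 := by exact_mod_cast h1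
    have h3 : (leftCard J.1 : ℝ) + rightCard J.1 = leftCard I.1 + rightCard I.1 + 1 := by
      exact_mod_cast h3
    linarith
  have key2 : ∀ v, v ∉ J.1 → I.1 ≠ insert v J.1 := by
    intro v hv h
    obtain ⟨h1, h2, h3⟩ := card_insert_bounds hv h
    have h2 : (rightCard J.1 : ℝ) ≤ rightCard I.1 := by exact_mod_cast h2
    have h3 : (leftCard I.1 : ℝ) + rightCard I.1 = leftCard J.1 + rightCard J.1 + 1 := by
      exact_mod_cast h3
    linarith
  exact ⟨glauber_eq_zero hne key1 key2, glauber_eq_zero hne.symm key2 key1⟩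

-- Since the balanced mass is at most `1 / 4`, one biased class has mass at least `3 / 8` and serves
-- as target. Starting from the other class, the bottleneck bound and `h` let its mass cancel.
open scoped Classical in
theorem le_of_mixed (hl : 0 < lam) (hδ0 : 0 < δ) (hδ : 1 ≤ 2 * (δ * n)) {r : ℝ} (hr0 : 0 < r)
    (hr : r ≤ 1 / 4)
    (h : gibbsProb G lam (nearlyBalanced G δ) ≤
      r * min (gibbsProb G lam (biasedLeft G δ)) (gibbsProb G lam (biasedRight G δ)))
    {t : ℕ} (ht : ∀ I : IndepSet G, tvDist ((glauber G lam ^ t) I) (gibbs G lam) ≤ 1 / 4) :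
    1 / (8 * r) ≤ t := by
  have hn : 0 < n := by
    rcases Nat.eq_zero_or_pos n with rfl | hn
    · norm_num at hδ
    · exact hn
  have hnonempty : Nonempty (Fin n ⊕ Fin n) := ⟨Sum.inl ⟨0, hn⟩⟩
  simp only [gibbsProb_eq_sum] at h
  set L := univ.filter (· ∈ biasedLeft G δ) with hL
  set R := univ.filter (· ∈ biasedRight G δ) with hR
  set B := univ.filter (· ∈ nearlyBalanced G δ) with hB
  set μ := gibbs G lam with hμ
  have hμ0 : ∀ I, 0 ≤ μ I := gibbs_nonneg hl
  have hmL : ∀ I, I ∈ L ↔ (rightCard I.1 : ℝ) + δ * n < leftCard I.1 := fun I => by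
    rw [hL, mem_filter_univ]; rfl
  have hmR : ∀ I, I ∈ R ↔ (leftCard I.1 : ℝ) + δ * n < rightCard I.1 := fun I => by
    rw [hR, mem_filter_univ]; rfl
  have hmB : ∀ I, I ∈ B ↔ (leftCard I.1 : ℝ) ≤ rightCard I.1 + δ * n ∧
      (rightCard I.1 : ℝ) ≤ leftCard I.1 + δ * n := fun I => by
    rw [hB, mem_filter_univ]; rfl
  have hcov : ∀ I, I ∈ L ∨ I ∈ B ∨ I ∈ R := by
    intro I
    rw [hmL, hmB, hmR]
    by_cases h1 : (rightCard I.1 : ℝ) + δ * n < leftCard I.1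
    · exact Or.inl h1
    · by_cases h2 : (leftCard I.1 : ℝ) + δ * n < rightCard I.1
      · exact Or.inr (Or.inr h2)
      · exact Or.inr (Or.inl ⟨not_lt.1 h1, not_lt.1 h2⟩)
  have hLR : Disjoint L R := by
    rw [disjoint_left]
    intro I h1 h2
    rw [hmL] at h1
    rw [hmR] at h2
    have : 0 ≤ δ * n := by positivity
    linarith
  have hsepL : ∀ I ∈ L, ∀ J ∈ R, glauber G lam I J = 0 := fun I hI J hJ =>
    (glauber_left_right_eq_zero hδ (mem_filter.1 hI).2 (mem_filter.1 hJ).2).1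
  have hsepR : ∀ I ∈ R, ∀ J ∈ L, glauber G lam I J = 0 := fun I hI J hJ =>
    (glauber_left_right_eq_zero hδ (mem_filter.1 hJ).2 (mem_filter.1 hI).2).2
  -- The empty set is balanced; positivity of this mass makes both biased masses positive, as the
  -- cancellation requires.
  have hBpos : 0 < ∑ I ∈ B, μ I := by
    have hmem : (⟨∅, by simp⟩ : IndepSet G) ∈ B := by
      have : 0 ≤ δ * n := by positivity
      have e1 : (∅ : Finset (Fin n ⊕ Fin n)).toLeft = ∅ := by ext; simp
      have e2 : (∅ : Finset (Fin n ⊕ Fin n)).toRight = ∅ := by ext; simp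
      rw [hmB]
      simp [leftCard, rightCard, e1, e2, this]
    refine lt_of_lt_of_le ?_ (single_le_sum (fun I _ => hμ0 I) hmem)
    simp only [hμ, gibbs]
    exact div_pos (by positivity) (partitionFunction_pos G hl)
  have hBL : ∑ I ∈ B, μ I ≤ r * ∑ I ∈ L, μ I :=
    h.trans (mul_le_mul_of_nonneg_left (min_le_left _ _) hr0.le)
  have hBR : ∑ I ∈ B, μ I ≤ r * ∑ I ∈ R, μ I :=
    h.trans (mul_le_mul_of_nonneg_left (min_le_right _ _) hr0.le)
  have htot : 1 ≤ ∑ I ∈ L, μ I + ∑ I ∈ B, μ I + ∑ I ∈ R, μ I := by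
    rw [← sum_gibbs (G := G) hl]
    have hu : (univ : Finset (IndepSet G)) = L ∪ B ∪ R := by
      ext I
      simpa [or_assoc] using hcov I
    have h1 := sum_union_inter (s₁ := L ∪ B) (s₂ := R) (f := μ)
    have h2 := sum_union_inter (s₁ := L) (s₂ := B) (f := μ)
    have h3 : 0 ≤ ∑ I ∈ (L ∪ B) ∩ R, μ I := sum_nonneg fun I _ => hμ0 I
    have h4 : 0 ≤ ∑ I ∈ L ∩ B, μ I := sum_nonneg fun I _ => hμ0 I
    rw [← hu] at h1
    linarith
  have hone : ∀ S : Finset (IndepSet G), ∑ I ∈ S, μ I ≤ 1 := fun S => by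
    rw [← sum_gibbs (G := G) hl]
    exact sum_le_sum_of_subset_of_nonneg (subset_univ _) fun I _ _ => hμ0 I
  have hBq : ∑ I ∈ B, μ I ≤ 1 / 4 := by
    have := mul_le_mul hr (hone L) (sum_nonneg fun I _ => hμ0 I) (by norm_num)
    linarith
  have hfin : ∀ X : Finset (IndepSet G), ∑ I ∈ B, μ I ≤ r * ∑ I ∈ X, μ I →
      1 / 8 * ∑ I ∈ X, μ I ≤ t * ∑ I ∈ B, μ I → 1 / (8 * r) ≤ t := by
    intro X h1 h2
    rw [div_le_iff₀ (by positivity)]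
    have hX : 0 < ∑ I ∈ X, μ I := pos_of_mul_pos_right (hBpos.trans_le h1) hr0.le
    have h3 := h2.trans (mul_le_mul_of_nonneg_left h1 (Nat.cast_nonneg t))
    rw [← mul_assoc] at h3
    have := le_of_mul_le_mul_right h3 hX
    linarith
  rcases le_or_gt (3 / 8) (∑ I ∈ R, μ I) with hc | hc
  · exact hfin L hBL (mass_le_of_tvDist_le (glauber G lam) μ (glauber_nonneg hl)
      (glauber_row_sum hl) hμ0 (sum_gibbs hl) (gibbs_stationary hl) L B R hcov hLR hsepL hc t ht)
  · have hc' : 3 / 8 ≤ ∑ I ∈ L, μ I := by linarith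
    exact hfin R hBR (mass_le_of_tvDist_le (glauber G lam) μ (glauber_nonneg hl)
      (glauber_row_sum hl) hμ0 (sum_gibbs hl) (gibbs_stationary hl) R B L
      (fun I => by rcases hcov I with h | h | h <;> simp [h]) hLR.symm hsepR hc' t ht)

theorem ofReal_le_mixingTime {x : ℝ}
    (h : ∀ t : ℕ, (∀ I : IndepSet G, tvDist ((glauber G lam ^ t) I) (gibbs G lam) ≤ 1 / 4) →
      x ≤ t) : ENNReal.ofReal x ≤ (mixingTime G lam : ℝ≥0∞) := by
  have h1 : ((⌈x⌉₊ : ℕ) : ℕ∞) ≤ mixingTime G lam := by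
    unfold mixingTime
    refine le_iInf₂ fun t ht => ?_
    exact_mod_cast Nat.ceil_le.2 (h t ht)
  have h2 : ENNReal.ofReal x ≤ ((⌈x⌉₊ : ℕ) : ℝ≥0∞) := by
    rw [← ENNReal.ofReal_natCast]
    exact ENNReal.ofReal_le_ofReal (Nat.le_ceil x)
  refine h2.trans ?_
  have := ENat.toENNReal_le.2 h1
  simpa using this

end Torpid

/-! ### Assembly of the two conclusions. -/

section Main

open Filter Topology Finset

/-- Above the critical activity the balanced independent sets are a bottleneck. -/
theorem exists_bimodality {lam : ℝ} (hlam : 4 < lam) :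
    ∃ ε : ℝ, 0 < ε ∧ ∃ δ : ℝ, 0 < δ ∧ AsymptoticallyAlmostSurely 3 (fun n G =>
      gibbsProb G lam (nearlyBalanced G δ) ≤ Real.exp (-(ε * n)) *
        min (gibbsProb G lam (biasedLeft G δ)) (gibbsProb G lam (biasedRight G δ))) := by
  classical
  have hl : 0 < lam := by linarith
  obtain ⟨δ, ε, x, y, hδ0, hδ1, hε, hxy, hd, hmax, hgap⟩ := exists_freeEnergy_gap hlam
  set M := freeEnergy lam x y with hM
  have hη : 0 < δ * ε := mul_pos hδ0 hε
  refine ⟨ε, hε, δ, hδ0, ?_⟩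
  have hr := (tendsto_tailBound hη).add (tendsto_tailBound hη)
  rw [add_zero] at hr
  refine asymptoticallyAlmostSurely_of_card_le hr ?_
  have hlarge : ∀ᶠ n : ℕ in atTop, 3 ≤ Real.exp (δ * ε * n) :=
    (Real.tendsto_exp_atTop.comp
      (tendsto_natCast_atTop_atTop.const_mul_atTop hη)).eventually_ge_atTop 3
  filter_upwards [hlarge, eventually_gt_atTop 0] with n hn3 hn
  have hn' : (0 : ℝ) < n := by exact_mod_cast hn
  set bal : ℕ → ℕ → Prop := fun a b => (a : ℝ) ≤ b + δ * n ∧ (b : ℝ) ≤ a + δ * n with hbal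
  have hregion : ∀ a b : ℕ, a + b ≤ n → ((a : ℝ) / n, (b : ℝ) / n) ∈ densityRegion := by
    intro a b hab
    have hab' : (a : ℝ) + b ≤ n := by exact_mod_cast hab
    refine ⟨by simp only; positivity, by simp only; positivity, ?_⟩
    simp only
    rw [← add_div, div_le_one hn']
    exact hab'
  have hT := card_weightOf_gt_le hn hl (fun _ _ => True) (K := M) (η := δ * ε)
    fun a b hab _ => hmax _ (hregion a b hab)
  have hB := card_weightOf_gt_le hn hl bal (K := M - 3 * ε) (η := δ * ε) (by
    intro a b hab hP
    refine hgap _ (hregion a b hab) ?_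
    simp only
    rw [← sub_div, abs_div, abs_of_pos hn', div_le_iff₀ hn', abs_le]
    constructor <;> linarith [hP.1, hP.2])
  rw [mul_add]
  -- Union bound: the inequality can fail only if the total or the balanced weight exceeds its
  -- Markov threshold.
  refine le_trans ?_ (add_le_add hT hB)
  rw [← Nat.cast_add]
  refine Nat.cast_le.2 (le_trans (card_le_card fun σ hσ => ?_) (card_union_le _ _))
  rw [mem_filter_univ] at hσ
  rw [mem_union, mem_filter_univ, mem_filter_univ]
  by_contra hcon
  push Not at hcon
  obtain ⟨hT', hB'⟩ := hcon
  refine hσ ?_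
  set G := unionOfMatchings σ
  have hZ := partitionFunction_pos G hl
  have e1 := partitionFunction_mul_gibbsProb σ hl bal (nearlyBalanced G δ) fun I => Iff.rfl
  have e2 := partitionFunction_mul_gibbsProb σ hl
    (fun a b => δ * n < (1 : ℝ) * ((a : ℝ) - b)) (biasedLeft G δ) fun I => by
      change (rightCard I.1 : ℝ) + δ * n < leftCard I.1 ↔ _
      constructor <;> intro h <;> linarith
  have e3 := partitionFunction_mul_gibbsProb σ hl
    (fun a b => δ * n < (-1 : ℝ) * ((a : ℝ) - b)) (biasedRight G δ) fun I => by
      change (leftCard I.1 : ℝ) + δ * n < rightCard I.1 ↔ _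
      constructor <;> intro h <;> linarith
  have hL := weightOf_balanced_le σ (M := M) hl hδ1 hε (s := 1) (by norm_num) hxy
    (by linarith) le_rfl hn3 hT' hB'
  have hyx : (y, x) ∈ densityRegion := ⟨hxy.2.1, hxy.1, by
    have := hxy.2.2
    simp only at this ⊢
    linarith⟩
  -- The reflected maximizer `(y, x)` with the opposite tilt treats the right side under the same
  -- two events.
  have hR := weightOf_balanced_le σ (M := M) hl hδ1 hε (s := -1) (by norm_num) hyx
    (by linarith) (by rw [hM, freeEnergy_comm]) hn3 hT' hB'
  rw [← e1, ← e2, mul_left_comm] at hL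
  rw [← e1, ← e3, mul_left_comm] at hR
  rw [mul_min_of_nonneg _ _ (Real.exp_pos _).le]
  exact le_min (le_of_mul_le_mul_left hL hZ) (le_of_mul_le_mul_left hR hZ)

end Main

end HardCore

theorem theorem2 (lam : ℝ) (hlam : HardCore.criticalActivity 3 < lam) :
    (∃ a : ℝ, 1 < a ∧ ∃ δ : ℝ, 0 < δ ∧
      HardCore.AsymptoticallyAlmostSurely 3 (fun n G =>
        HardCore.gibbsProb G lam (HardCore.nearlyBalanced G δ) ≤
          a ^ (-(n : ℤ)) * min (HardCore.gibbsProb G lam (HardCore.biasedLeft G δ))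
            (HardCore.gibbsProb G lam (HardCore.biasedRight G δ)))) ∧
    (∃ c : ℝ, 0 < c ∧
      HardCore.AsymptoticallyAlmostSurely 3 (fun n G =>
        ENNReal.ofReal (Real.exp (c * n)) ≤ (HardCore.mixingTime G lam : ℝ≥0∞))) := by
  rw [HardCore.criticalActivity_three] at hlam
  have hl : 0 < lam := by linarith
  obtain ⟨ε, hε, δ, hδ, h⟩ := HardCore.exists_bimodality hlam
  refine ⟨⟨Real.exp ε, Real.one_lt_exp_iff.2 hε, δ, hδ, ?_⟩, ε / 2, by positivity, ?_⟩
  · refine h.mono (Filter.Eventually.of_forall fun n G hG => ?_)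
    rwa [zpow_neg, zpow_natCast, ← Real.exp_nat_mul, ← Real.exp_neg, mul_comm (n : ℝ)]
  · refine h.mono ?_
    have h1 : ∀ᶠ n : ℕ in Filter.atTop, 1 ≤ 2 * δ * (n : ℝ) :=
      (tendsto_natCast_atTop_atTop.const_mul_atTop
        (show 0 < 2 * δ by positivity)).eventually_ge_atTop 1
    -- Half of the exponent `ε` absorbs the factor `8` in the bound `1 / (8 * r)`, which explains `c
    -- = ε / 2`.
    have h2 : ∀ᶠ n : ℕ in Filter.atTop, 8 ≤ Real.exp (ε / 2 * n) :=
      (Real.tendsto_exp_atTop.comp (tendsto_natCast_atTop_atTop.const_mul_atTop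
        (show 0 < ε / 2 by positivity))).eventually_ge_atTop 8
    filter_upwards [h1, h2] with n hn1 hn2 G hG
    have hsq : Real.exp (ε / 2 * n) * Real.exp (ε / 2 * n) * Real.exp (-(ε * n)) = 1 := by
      rw [← Real.exp_add, ← Real.exp_add, ← Real.exp_zero]
      congr 1
      ring
    have hr : Real.exp (-(ε * n)) ≤ 1 / 4 := by
      nlinarith [Real.exp_pos (-(ε * n)), mul_le_mul hn2 hn2 (by norm_num) (by positivity)]
    refine HardCore.ofReal_le_mixingTime fun t ht => ?_
    refine le_trans ?_ (HardCore.le_of_mixed hl hδ (by linarith) (Real.exp_pos _) hr hG ht)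
    rw [le_div_iff₀ (by positivity)]
    nlinarith [mul_le_mul_of_nonneg_right hn2
      (mul_pos (Real.exp_pos (ε / 2 * n)) (Real.exp_pos (-(ε * n)))).le]
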